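/- **Theorem 4.** *The MinBasis-Cardinality problem.* An instance consists of $n$ items, independent random weights $X_1,\dots,X_n$ with known laws on $\{0,1,\dots,m\}$, a matroid $\mathcal M$ of rank $k$ on the set of items, and a budget $B\in\mathbb N$. An adaptive policy $\pi$ probes items one by one; the weight of an item is revealed when it is probed, and each decision (which item to probe next, or to stop) may depend on all weights seen so far. Let $S^{(\pi)}$ be the random set of probed items. For a set $S$ of items let $f(S)=\min\{\sum_{e\in T}X_e : T\subseteq S,\ T\text{ a basis of }\mathcal M\}$, with $f(S)=+\infty$ if $S$ contains no basis. A set is feasible if it has at most $B$ elements, and a policy is admissible if $S^{(\pi)}$ is always feasible. A policy $\pi$ is an $(\alpha,\beta)$-approximation if $S^{(\pi)}$ is always the union of at most $\beta$ feasible sets and $\mathbb E[f(S^{(\pi)})]\le\alpha\,\mathbb E[f(S^{(\pi')})]$ for every admissible adaptive policy $\pi'$. There are an absolute constant $C$ and an algorithm that, on every instance, carries out an adaptive policy which is an $(8,\ C\cdot\max\{1,\log\log m\}\cdot\max\{1,\log k\})$-approximation, that is, an $(8, O(\log\log m\cdot\log k))$-approximation (with the convention $\max\{1,\log\log m\}=1$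 for $m\le 1$ and $\max\{1,\log k\}=1$ for $k=0$). The algorithm is efficient: it takes a number of steps polynomial in $n$ and $\log m$ on a unit-cost random access machine (without multiplication) that is given $n$, $m$ and $B$ and that, in a single step, may probe an item, may ask an oracle whether a set of items is independent in $\mathcal M$, and may ask an oracle whether $\Pr[X_e\le t]\le\Pr[X_{e'}\le t]$ for two items $e,e'$ and a number $t$. -/

import Mathlib

open scoped ENNReal

noncomputable section

namespace MinBasis

/-- An instance of MinBasis-Cardinality: the items are `0, …, n - 1`, item `e` carries an independent
random weight with law `dist e` on `{0, …, m}`, `M` is the matroid of the objective, and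
at most `B` items may be probed. -/
structure Instance (n m : ℕ) where
  M : Matroid (Fin n)
  ground_eq : M.E = Set.univ
  B : ℕ
  dist : Fin n → PMF (Fin (m + 1))

/-- An adaptive policy: finish, or probe an item and continue depending on the observed weight. -/
inductive Policy (n m : ℕ) where
  | done : Policy n m
  | probe (e : Fin n) (next : Fin (m + 1) → Policy n m) : Policy n m

/-- The set of items probed by a policy when the weights are `x`. -/
def Policy.selected {n m : ℕ} : Policy n m → (Fin n → Fin (m + 1)) → Finset (Fin n)
  | .done, _ => ∅
  | .probe e next, x => insert e ((next (x e)).selected x)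

namespace Instance

variable {n m : ℕ}

/-- The constraint family: sets of at most `B` items. -/
def Feasible (I : Instance n m) (S : Finset (Fin n)) : Prop := S.card ≤ I.B

/-- Policies that respect the constraint whatever the weights turn out to be. -/
def Admissible (I : Instance n m) (π : Policy n m) : Prop :=
  ∀ x : Fin n → Fin (m + 1), I.Feasible (π.selected x)

/-- The least weight of a basis of the matroid contained in `S` (`∞` if `S` contains no basis). -/
def objective (I : Instance n m) (x : Fin n → Fin (m + 1)) (S : Finset (Fin n)) : ℝ≥0∞ :=
  ⨅ T : {T : Finset (Fin n) // T ⊆ S ∧ I.M.IsBase (T : Set (Fin n))},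
    ∑ e ∈ T.1, ((x e : ℕ) : ℝ≥0∞)

/-- The expected objective value of a policy, the weights being independent. -/
def expectedObjective (I : Instance n m) (π : Policy n m) : ℝ≥0∞ :=
  ∑ x : Fin n → Fin (m + 1), (∏ e, I.dist e (x e)) * I.objective x (π.selected x)

/-- `π` is an `(α, β)`-approximation: its selection is always a union of at most `β` feasible sets,
and its expected objective is at most `α` times that of every admissible policy. -/
def IsApproximation (I : Instance n m) (α : ℝ≥0∞) (β : ℝ) (π : Policy n m) : Prop :=
  (∀ x : Fin n → Fin (m + 1), ∃ (N : ℕ) (F : Fin N → Finset (Fin n)),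
      (N : ℝ) ≤ β ∧ (∀ j, I.Feasible (F j)) ∧ π.selected x = Finset.univ.biUnion F) ∧
  ∀ π' : Policy n m, I.Admissible π' →
    I.expectedObjective π ≤ α * I.expectedObjective π'

/-- The probability that the weight of item `e` is at most `t`. -/
def cdf (I : Instance n m) (e : Fin n) (t : ℕ) : ℝ≥0∞ :=
  ∑ v : Fin (m + 1), if (v : ℕ) ≤ t then I.dist e v else 0

end Instance

/-! A unit-cost random access machine, programmed by structured programs, with oracle access to the
matroid and to the laws of the weights. There is no multiplication, so that the bit length of
the numbers grows by at most a constant in each step. -/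

/-- The memory: array `a` holds the natural number `s a i` at index `i`. -/
abbrev Memory := ℕ → ℕ → ℕ

/-- The memory with the entry of array `a` at index `i` overwritten by `v`. -/
def Memory.write (s : Memory) (a i v : ℕ) : Memory :=
  fun a' i' => if a' = a ∧ i' = i then v else s a' i'

/-- Arithmetic expressions; `read a i` is the entry of array `a` at the index given by `i`,
`sub` is truncated subtraction and `half` is rounded down. -/
inductive Expr where
  | const (c : ℕ)
  | read (a : ℕ) (i : Expr)
  | add (p q : Expr)
  | sub (p q : Expr)
  | half (p : Expr)

def Expr.eval (s : Memory) : Expr → ℕ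
  | .const c => c
  | .read a i => s a (i.eval s)
  | .add p q => p.eval s + q.eval s
  | .sub p q => p.eval s - q.eval s
  | .half p => p.eval s / 2

/-- Programs. A condition holds if its value is not `0`. The last three commands are the oracles;
each of them writes its answer to index `0` of array `r`.
* `indep a r`: is the set of the items `e` whose entry in array `a` is not `0` independent?
* `compare p q t r`: for the items `e, e'` and the number `t` given by the expressions
  `p, q, t`, is the probability of `X e ≤ t` at most the probability of `X e' ≤ t`?
* `probe p r`: probe the item given by `p` and observe its weight. -/
inductive Program where
  | skip
  | assign (a : ℕ) (i p : Expr)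
  | seq (c d : Program)
  | ifThenElse (b : Expr) (c d : Program)
  | while (b : Expr) (c : Program)
  | indep (a r : ℕ)
  | compare (p q t : Expr) (r : ℕ)
  | probe (p : Expr) (r : ℕ)

/-- A configuration: the commands still to be executed, in order, and the memory. -/
structure Config where
  todo : List Program
  mem : Memory

/-- What a machine does next: it has halted, it moves on by itself, or it probes an item and moves on
depending on the observed weight. -/
inductive Action (n m : ℕ) where
  | halt
  | move (c : Config)
  | probe (e : Fin n) (next : Fin (m + 1) → Config)

open Classical in
/-- The transition function of the machine. A query about a number that is not an item is
answered by `0`. -/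
def Config.action {n m : ℕ} (I : Instance n m) : Config → Action n m
  | ⟨[], _⟩ => .halt
  | ⟨.skip :: K, s⟩ => .move ⟨K, s⟩
  | ⟨.assign a i p :: K, s⟩ => .move ⟨K, s.write a (i.eval s) (p.eval s)⟩
  | ⟨.seq c d :: K, s⟩ => .move ⟨c :: d :: K, s⟩
  | ⟨.ifThenElse b c d :: K, s⟩ => .move ⟨(if b.eval s ≠ 0 then c else d) :: K, s⟩
  | ⟨.while b c :: K, s⟩ =>
      .move ⟨if b.eval s ≠ 0 then c :: .while b c :: K else K, s⟩
  | ⟨.indep a r :: K, s⟩ =>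
      .move ⟨K, s.write r 0 (if I.M.Indep {e : Fin n | s a e ≠ 0} then 1 else 0)⟩
  | ⟨.compare p q t r :: K, s⟩ =>
      .move ⟨K, s.write r 0
        (if ∃ (hp : p.eval s < n) (hq : q.eval s < n),
            I.cdf ⟨p.eval s, hp⟩ (t.eval s) ≤ I.cdf ⟨q.eval s, hq⟩ (t.eval s)
          then 1 else 0)⟩
  | ⟨.probe p r :: K, s⟩ =>
      if h : p.eval s < n then .probe ⟨p.eval s, h⟩ (fun v => ⟨K, s.write r 0 v⟩)
      else .move ⟨K, s.write r 0 0⟩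

/-- `Runs I T c π`: started in the configuration `c`, the machine halts after at most `T` steps,
whatever weights it observes, and the probes that it makes are those of the policy `π`. -/
inductive Runs {n m : ℕ} (I : Instance n m) : ℕ → Config → Policy n m → Prop where
  | halt {T : ℕ} {c : Config} (h : c.action I = .halt) : Runs I T c .done
  | move {T : ℕ} {c c' : Config} {π : Policy n m} (h : c.action I = .move c')
      (hr : Runs I T c' π) : Runs I (T + 1) c π
  | probe {T : ℕ} {c : Config} {e : Fin n} {next : Fin (m + 1) → Config}
      {π : Fin (m + 1) → Policy n m} (h : c.action I = .probe e next)
      (hr : ∀ v, Runs I T (next v) (π v)) : Runs I (T + 1) c (.probe e π)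

/-- The initial memory: array `0` starts with the numbers `n`, `m`, `B`; the rest is `0`. -/
def Instance.input {n m : ℕ} (I : Instance n m) : Memory :=
  fun a i => if a = 0 then (if i = 0 then n else if i = 1 then m else if i = 2 then I.B else 0)
    else 0

/-- On the instance `I`, the program `P` carries out the policy `π` in at most `T` steps. -/
def Program.Implements {n m : ℕ} (P : Program) (I : Instance n m) (T : ℕ) (π : Policy n m) :
    Prop :=
  Runs I T ⟨[P], I.input⟩ π

end MinBasis

end

/-! The algorithm builds an independent set `F` of probed items in phases. A phase that starts `d`
elements short of a basis adds `quota d`, about `d / 4`, elements whose weights are at most a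
threshold among `0, 1, 2, 4, …`; the threshold is found by binary search. To test a threshold `t`,
at most `B` items are probed, each time one outside the span of the current extension `G` of `F`
that is most likely to have weight at most `t`. There are `O(log k)` phases with `O(log log m)`
tests each, which bounds the number of feasible sets.

The heart is `exchange`, a greedy argument against an adaptive policy `A` with at most `B` probes.
It follows the rank of `G` together with the light items (weight at most `t`) that `A` selects, plus
`|G|`. When the greedy item `e` is probed, `A` gives up one probe: that of `e` if it meets it,
otherwise the last one its budget allows. Giving up an item costs at most one unit of rank, and this
happens with at most the probability with which `e` adds one to `|G|`; so the chance that the sum is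
small does not increase. If the test stops short of its target size `θ`, the sum is just `2 * |G| ≤
2 * θ - 2`. Hence a test fails with at most the probability that the light items of `A` miss full
rank by `d + 2 - 2 * quota d`, about `d / 2` (`achieves_probeLoop`, `shortfall_le`). All this is
conditional on the weights seen so far, so `A` can be used afresh in every test.

For the cost, a failure at threshold `a` raises the price of an element to threshold `a + 1`
(`achieves_searchLoop`). Over all phases, a deficit `δ` of `A` is charged for at most `2 * δ`
elements (`charge_le_two_mul`), and `δ` is at most the number of heavier elements in any basis that
`A` has found. The doubling thresholds below a weight `v` contribute at most `4 * v`, and `2 * 4 =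
8`. The program does not depend on `A`, so by `Runs.unique` one policy competes with every `A`. -/

noncomputable section

namespace MinBasis

variable {n m : ℕ}

/-! ### Ranks of sets of items -/

section Rank

variable {α : Type*} [Finite α] (M : Matroid α)

/-- The rank of a set of elements of a finite matroid, as a natural number. -/
def rk (S : Set α) : ℕ := (M.eRk S).toNat

theorem cast_rk (S : Set α) : ((rk M S : ℕ) : ℕ∞) = M.eRk S := by
  refine ENat.natCast_toNat ?_
  have h := M.eRk_le_encard S
  have h2 : S.encard ≠ ⊤ := by
    rw [Set.encard_ne_top_iff]; exact Set.toFinite S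
  exact ne_top_of_le_ne_top h2 h

theorem rk_mono {S T : Set α} (h : S ⊆ T) : rk M S ≤ rk M T := by
  have := M.eRk_mono h
  rw [← cast_rk, ← cast_rk] at this
  exact_mod_cast this

theorem rk_insert_le (a : α) (S : Set α) : rk M (insert a S) ≤ rk M S + 1 := by
  have := M.eRk_union_le_eRk_add_encard S {a}
  rw [Set.union_singleton, Set.encard_singleton, ← cast_rk, ← cast_rk] at this
  exact_mod_cast this

theorem rk_union_of_subset_closure {S T : Set α} (h : T ⊆ M.closure S) :
    rk M (S ∪ T) = rk M S := by
  refine le_antisymm ?_ (rk_mono M Set.subset_union_left)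
  have h1 : M.eRk (S ∪ T) ≤ M.eRk (S ∪ M.closure S) := M.eRk_mono (Set.union_subset_union_right _ h)
  rw [Matroid.eRk_union_closure_right_eq, Set.union_self, ← cast_rk, ← cast_rk] at h1
  exact_mod_cast h1

theorem rk_insert_of_mem_closure {a : α} {S : Set α} (h : a ∈ M.closure S) :
    rk M (insert a S) = rk M S := by
  rw [← Set.union_singleton]
  exact rk_union_of_subset_closure M (Set.singleton_subset_iff.2 h)

theorem rk_coe_of_indep {G : Finset α} (h : M.Indep (G : Set α)) : rk M (G : Set α) = G.card := by
  have := h.eRk_eq_encard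
  rw [← cast_rk, Set.encard_coe_eq_coe_finsetCard] at this
  exact_mod_cast this

theorem card_le_rk {G : Finset α} {S : Set α} (h : M.Indep (G : Set α)) (hS : (G : Set α) ⊆ S) :
    G.card ≤ rk M S :=
  (rk_coe_of_indep M h).symm.trans_le (rk_mono M hS)

end Rank


/-! ### Expectations under product laws -/

/-- The expectation of `φ` if the weights are independent with laws `D`. -/
def expect (D : Fin n → PMF (Fin (m + 1))) (φ : (Fin n → Fin (m + 1)) → ℝ≥0∞) : ℝ≥0∞ :=
  ∑ x : Fin n → Fin (m + 1), (∏ e, D e (x e)) * φ x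

/-- Outcomes of probability zero may be ignored. With point masses for the probed items, this lets
the observed weights be used inside an expectation. -/
theorem expect_mono_of_support {D : Fin n → PMF (Fin (m + 1))}
    {φ ψ : (Fin n → Fin (m + 1)) → ℝ≥0∞} (h : ∀ x, (∀ e, D e (x e) ≠ 0) → φ x ≤ ψ x) :
    expect D φ ≤ expect D ψ := by
  refine Finset.sum_le_sum fun x _ => ?_
  by_cases hx : ∀ e, D e (x e) ≠ 0
  · gcongr
    exact h x hx
  · push Not at hx
    obtain ⟨e, he⟩ := hx
    rw [Finset.prod_eq_zero (Finset.mem_univ e) he]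
    simp

theorem expect_mono {D : Fin n → PMF (Fin (m + 1))}
    {φ ψ : (Fin n → Fin (m + 1)) → ℝ≥0∞} (h : ∀ x, φ x ≤ ψ x) : expect D φ ≤ expect D ψ :=
  expect_mono_of_support fun x _ => h x

theorem expect_congr_of_support {D : Fin n → PMF (Fin (m + 1))}
    {φ ψ : (Fin n → Fin (m + 1)) → ℝ≥0∞} (h : ∀ x, (∀ e, D e (x e) ≠ 0) → φ x = ψ x) :
    expect D φ = expect D ψ :=
  le_antisymm (expect_mono_of_support fun x hx => (h x hx).le)
    (expect_mono_of_support fun x hx => (h x hx).ge)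

theorem sum_pmf {α : Type*} [Fintype α] (p : PMF α) : ∑ v, p v = 1 := by
  rw [← tsum_fintype (L := .unconditional α)]; exact p.tsum_coe

theorem expect_const (D : Fin n → PMF (Fin (m + 1))) (c : ℝ≥0∞) :
    expect D (fun _ => c) = c := by
  have h := Finset.prod_univ_sum (fun _ : Fin n => (Finset.univ : Finset (Fin (m + 1))))
    (fun e v => D e v)
  rw [Fintype.piFinset_univ] at h
  unfold expect
  rw [← Finset.sum_mul, ← h]
  simp [sum_pmf]

theorem expect_add (D : Fin n → PMF (Fin (m + 1))) (φ ψ : (Fin n → Fin (m + 1)) → ℝ≥0∞) :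
    expect D (fun x => φ x + ψ x) = expect D φ + expect D ψ := by
  simp only [expect, mul_add, Finset.sum_add_distrib]

theorem expect_mul_left (D : Fin n → PMF (Fin (m + 1))) (c : ℝ≥0∞)
    (φ : (Fin n → Fin (m + 1)) → ℝ≥0∞) : expect D (fun x => c * φ x) = c * expect D φ := by
  simp only [expect, Finset.mul_sum]
  exact Finset.sum_congr rfl fun x _ => by ring

/-- Conditioning on the weight of the item `e`. -/
theorem expect_eq_sum_update (D : Fin n → PMF (Fin (m + 1))) (e : Fin n)
    (φ : (Fin n → Fin (m + 1)) → ℝ≥0∞) :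
    expect D φ = ∑ v, D e v * expect (Function.update D e (PMF.pure v)) φ := by
  unfold expect
  simp only [Finset.mul_sum]
  rw [Finset.sum_comm]
  refine Finset.sum_congr rfl fun x _ => ?_
  -- The point mass at `v` keeps only outcomes with `x e = v`; the outer factor `D e v` then
  -- restores the missing factor of the product.
  have hprod : ∀ v, ∏ e', Function.update D e (PMF.pure v) e' (x e')
      = (if x e = v then 1 else 0) * ∏ e' ∈ Finset.univ.erase e, D e' (x e') := by
    intro v
    have hrest : ∏ e' ∈ Finset.univ.erase e, Function.update D e (PMF.pure v) e' (x e')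
        = ∏ e' ∈ Finset.univ.erase e, D e' (x e') :=
      Finset.prod_congr rfl fun e' he' => by
        rw [Function.update_of_ne (Finset.ne_of_mem_erase he')]
    rw [← Finset.mul_prod_erase Finset.univ
      (fun e' => Function.update D e (PMF.pure v) e' (x e')) (Finset.mem_univ e),
      Function.update_self, PMF.pure_apply, hrest]
    split_ifs <;> rfl
  simp only [hprod, ite_mul, one_mul, zero_mul, mul_ite, mul_zero, Finset.sum_ite_eq,
    Finset.mem_univ, if_true]
  rw [← mul_assoc, Finset.mul_prod_erase Finset.univ (fun e' => D e' (x e')) (Finset.mem_univ e)]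

theorem eq_of_update_pure_ne_zero {D : Fin n → PMF (Fin (m + 1))} {e : Fin n}
    {v : Fin (m + 1)} {x : Fin n → Fin (m + 1)}
    (h : ∀ e', Function.update D e (PMF.pure v) e' (x e') ≠ 0) : x e = v := by
  have := h e
  rw [Function.update_self, PMF.pure_apply] at this
  by_contra hne
  simp [hne] at this

/-- The probability that the weight of `e` is at most `t` if its law is `D e`. -/
def lawCdf (D : Fin n → PMF (Fin (m + 1))) (e : Fin n) (t : ℕ) : ℝ≥0∞ :=
  ∑ v : Fin (m + 1), if (v : ℕ) ≤ t then D e v else 0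

theorem lawCdf_update_of_ne {D : Fin n → PMF (Fin (m + 1))} {a e : Fin n} (h : a ≠ e)
    (p : PMF (Fin (m + 1))) (t : ℕ) : lawCdf (Function.update D e p) a t = lawCdf D a t := by
  simp [lawCdf, Function.update_of_ne h]

theorem lawCdf_eq_zero_of_pure {D : Fin n → PMF (Fin (m + 1))} {e : Fin n} {v : Fin (m + 1)}
    {t : ℕ} (h : D e = PMF.pure v) (hv : ¬ (v : ℕ) ≤ t) : lawCdf D e t = 0 := by
  refine Finset.sum_eq_zero fun w _ => ?_
  rw [h, PMF.pure_apply]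
  split_ifs with h1 h2
  · subst h2; exact absurd h1 hv
  · rfl
  · rfl

theorem lawCdf_le_one (D : Fin n → PMF (Fin (m + 1))) (e : Fin n) (t : ℕ) : lawCdf D e t ≤ 1 := by
  rw [← sum_pmf (D e)]
  exact Finset.sum_le_sum fun v _ => by split_ifs <;> simp

theorem sum_pmf_ite (D : Fin n → PMF (Fin (m + 1))) (e : Fin n) (t : ℕ)
    (u w : ℝ≥0∞) :
    ∑ v, D e v * (if (v : ℕ) ≤ t then u else w)
      = lawCdf D e t * u + (1 - lawCdf D e t) * w := by
  have h1 : (1 - lawCdf D e t) = ∑ v : Fin (m + 1), if (v : ℕ) ≤ t then 0 else D e v := by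
    refine ENNReal.sub_eq_of_eq_add ((lawCdf_le_one D e t).trans_lt ENNReal.one_lt_top).ne ?_
    rw [lawCdf, ← Finset.sum_add_distrib, ← sum_pmf (D e)]
    exact Finset.sum_congr rfl fun v _ => by split_ifs <;> simp
  rw [h1, lawCdf, Finset.sum_mul, Finset.sum_mul, ← Finset.sum_add_distrib]
  exact Finset.sum_congr rfl fun v _ => by split_ifs <;> simp

/-- The mass `r = p - q` moves from the larger value `w` to the smaller value `u`. -/
theorem mix_le_mix {p q u w : ℝ≥0∞} (hqp : q ≤ p) (hp : p ≤ 1) (h : u ≤ w) :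
    p * u + (1 - p) * w ≤ q * u + (1 - q) * w := by
  have hp' : p ≠ ⊤ := (hp.trans_lt ENNReal.one_lt_top).ne
  have hq' : q ≠ ⊤ := (hqp.trans_lt hp'.lt_top).ne
  obtain ⟨r, rfl⟩ : ∃ r, p = q + r := ⟨p - q, (add_tsub_cancel_of_le hqp).symm⟩
  have hs : 1 - q = r + (1 - (q + r)) := by
    refine ENNReal.sub_eq_of_eq_add hq' ?_
    rw [add_comm r, add_assoc, add_comm r q, tsub_add_cancel_of_le hp]
  rw [hs, add_mul, add_mul, add_assoc]
  gcongr

/-! ### Policies -/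

/-- The largest number of probes that a policy may make. -/
def Policy.depth : Policy n m → ℕ
  | .done => 0
  | .probe _ next => (Finset.univ.sup fun v => (next v).depth) + 1

theorem Policy.depth_next_le {e : Fin n} {next : Fin (m + 1) → Policy n m} {b : ℕ}
    (h : (Policy.probe e next).depth ≤ b + 1) (v : Fin (m + 1)) : (next v).depth ≤ b := by
  simp only [Policy.depth] at h
  exact (Finset.le_sup (f := fun v => (next v).depth) (Finset.mem_univ v)).trans (by omega)

theorem Policy.depth_probe_le {e : Fin n} {next : Fin (m + 1) → Policy n m} {b : ℕ}
    (h : ∀ v, (next v).depth ≤ b) : (Policy.probe e next).depth ≤ b + 1 := by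
  simp only [Policy.depth, add_le_add_iff_right]
  exact Finset.sup_le fun v _ => h v

theorem Policy.eq_done_of_depth {π : Policy n m} (h : π.depth ≤ 0) : π = .done := by
  cases π with
  | done => rfl
  | probe e next => simp [Policy.depth] at h

/-- Omitting repeated probes, a policy that selects at most `b` items makes at most `b` probes. -/
theorem Policy.exists_depth_le (π : Policy n m) :
    ∀ (Z : Finset (Fin n)) (y : Fin n → Fin (m + 1)) (b : ℕ),
      (∀ x, (∀ e ∈ Z, x e = y e) → (π.selected x \ Z).card ≤ b) →
      ∃ π' : Policy n m, π'.depth ≤ b ∧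
        ∀ x, (∀ e ∈ Z, x e = y e) → Z ∪ π'.selected x = Z ∪ π.selected x := by
  induction π with
  | done => exact fun Z y b _ => ⟨.done, Nat.zero_le _, fun x _ => rfl⟩
  | probe e next ih =>
    intro Z y b h
    -- The weight of an item of `Z` is already fixed by `y`, so a repeated probe is replaced by the
    -- branch it leads to.
    by_cases he : e ∈ Z
    · obtain ⟨π', h1, h2⟩ := ih (y e) Z y b fun x hx => by
        have := h x hx
        rwa [Policy.selected, Finset.insert_sdiff_of_mem _ he, hx e he] at this
      refine ⟨π', h1, fun x hx => ?_⟩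
      rw [h2 x hx, Policy.selected, hx e he, Finset.union_insert, Finset.insert_eq_of_mem]
      exact Finset.mem_union_left _ he
    · have hb : 1 ≤ b := by
        refine le_trans ?_ (h y fun _ _ => rfl)
        rw [Finset.one_le_card]
        exact ⟨e, by simp [Policy.selected, he]⟩
      obtain ⟨b, rfl⟩ := Nat.exists_eq_add_of_le' hb
      have key : ∀ v, ∃ π' : Policy n m, π'.depth ≤ b ∧
          ∀ x, (∀ a ∈ insert e Z, x a = Function.update y e v a) →
            insert e Z ∪ π'.selected x = insert e Z ∪ (next v).selected x := by
        intro v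
        refine ih v (insert e Z) (Function.update y e v) b fun x hx => ?_
        have hxe : x e = v := by simpa using hx e (Finset.mem_insert_self _ _)
        have hxZ : ∀ a ∈ Z, x a = y a := fun a ha => by
          have := hx a (Finset.mem_insert_of_mem ha)
          rwa [Function.update_of_ne (ne_of_mem_of_not_mem ha he)] at this
        have := h x hxZ
        rw [Policy.selected, hxe] at this
        have hc : insert e ((next v).selected x) \ Z
            = insert e ((next v).selected x \ insert e Z) := by
          ext a; by_cases hae : a = e <;> simp [hae, he]
        rw [hc, Finset.card_insert_of_notMem (by simp)] at this
        omega
      choose f hf1 hf2 using key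
      refine ⟨.probe e f, Policy.depth_probe_le hf1, fun x hx => ?_⟩
      have := hf2 (x e) x fun a ha => by
        rcases Finset.mem_insert.1 ha with rfl | ha
        · simp
        · rw [Function.update_of_ne (ne_of_mem_of_not_mem ha he)]; exact hx a ha
      simpa [Policy.selected, Finset.union_insert, Finset.insert_union] using this

theorem Policy.exists_depth_le_of_card_le (π : Policy n m) (b : ℕ)
    (h : ∀ x, (π.selected x).card ≤ b) :
    ∃ π' : Policy n m, π'.depth ≤ b ∧ ∀ x, π'.selected x = π.selected x := by
  obtain ⟨π', h1, h2⟩ := π.exists_depth_le ∅ (fun _ => 0) b fun x _ => by simpa using h x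
  exact ⟨π', h1, fun x => by simpa using h2 x (by simp)⟩

/-- The items of `S` of weight at most `t`. -/
def light (x : Fin n → Fin (m + 1)) (t : ℕ) (S : Finset (Fin n)) : Finset (Fin n) :=
  S.filter fun e => (x e : ℕ) ≤ t

theorem light_insert (x : Fin n → Fin (m + 1)) (t : ℕ) (a : Fin n) (S : Finset (Fin n)) :
    light x t (insert a S) = if (x a : ℕ) ≤ t then insert a (light x t S) else light x t S :=
  Finset.filter_insert ..

/-! ### The greedy choice of an item -/

section Exchange

variable (M : Matroid (Fin n))

/-- The event that the light items of `S`, together with `G` and `Y`, fall short of the rank which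
makes a target of `θ / 2` plausible for an extension of `G`. -/
def shortfall (θ t : ℕ) (G Y : Finset (Fin n)) (x : Fin n → Fin (m + 1)) (S : Finset (Fin n)) :
    ℝ≥0∞ :=
  if rk M ((G ∪ Y ∪ light x t S : Finset (Fin n)) : Set (Fin n)) + G.card + 1 < θ then 1 else 0

variable {M}

theorem shortfall_le_of {θ t : ℕ} {G Y G' Y' : Finset (Fin n)} {x x' : Fin n → Fin (m + 1)}
    {S S' : Finset (Fin n)}
    (h : rk M ((G' ∪ Y' ∪ light x' t S' : Finset (Fin n)) : Set (Fin n)) + G'.card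
      ≤ rk M ((G ∪ Y ∪ light x t S : Finset (Fin n)) : Set (Fin n)) + G.card) :
    shortfall M θ t G Y x S ≤ shortfall M θ t G' Y' x' S' := by
  unfold shortfall
  split_ifs with h1 h2
  · exact le_rfl
  · omega
  · exact zero_le_one
  · exact le_rfl

theorem shortfall_congr {θ t : ℕ} {G Y Y' : Finset (Fin n)} {x x' : Fin n → Fin (m + 1)}
    {S S' : Finset (Fin n)} (h : Y ∪ light x t S = Y' ∪ light x' t S') :
    shortfall M θ t G Y x S = shortfall M θ t G Y' x' S' := by
  unfold shortfall
  rw [Finset.union_assoc, h, Finset.union_assoc]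

/-- Observing an item first, its shortfall is that of the remaining policy. -/
theorem expect_shortfall_probe (θ t : ℕ) (G Y : Finset (Fin n)) (D : Fin n → PMF (Fin (m + 1)))
    (a : Fin n) (next : Fin (m + 1) → Policy n m) :
    expect D (fun x => shortfall M θ t G Y x ((Policy.probe a next).selected x))
      = ∑ w, D a w * expect (Function.update D a (PMF.pure w)) (fun x =>
          shortfall M θ t G (if (w : ℕ) ≤ t then insert a Y else Y) x ((next w).selected x)) := by
  rw [expect_eq_sum_update D a]
  refine Finset.sum_congr rfl fun w _ => ?_
  congr 1
  refine expect_congr_of_support fun x hx => shortfall_congr ?_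
  have hxa := eq_of_update_pure_ne_zero hx
  rw [Policy.selected, light_insert, hxa]
  split_ifs <;> simp

/-- If no item outside the span of `G ∪ Y` is more likely to be light than `e`, then probing `e` first loses
nothing: whatever the outcome, some policy with one probe less has the same chance of a shortfall. -/
theorem exchange (hE : M.E = Set.univ) {θ t : ℕ} {G : Finset (Fin n)} {e : Fin n}
    (heG : e ∉ G) (A : Policy n m) :
    ∀ (b : ℕ) (D : Fin n → PMF (Fin (m + 1))) (Y : Finset (Fin n)), A.depth ≤ b + 1 →
      (∀ a, a ≠ e → a ∈ M.closure ((G ∪ Y : Finset (Fin n)) : Set (Fin n)) ∨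
        lawCdf D a t ≤ lawCdf D e t) →
      ∃ Av : Fin (m + 1) → Policy n m, (∀ v, (Av v).depth ≤ b) ∧
        ∑ v, D e v * expect (Function.update D e (PMF.pure v)) (fun x =>
            shortfall M θ t (if (v : ℕ) ≤ t then insert e G else G) Y x ((Av v).selected x))
          ≤ expect D (fun x => shortfall M θ t G Y x (A.selected x)) := by
  have hgain : ∀ (Y : Finset (Fin n)) (v : Fin (m + 1)) (x : Fin n → Fin (m + 1))
      (S : Finset (Fin n)),
      shortfall M θ t (if (v : ℕ) ≤ t then insert e G else G) Y x S ≤ shortfall M θ t G Y x S := by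
    intro Y v x S
    apply shortfall_le_of
    split_ifs
    · refine add_le_add (rk_mono M ?_) (Finset.card_le_card (Finset.subset_insert _ _))
      gcongr
      exact Finset.subset_insert _ _
    · exact le_rfl
  induction A with
  | done =>
    intro b D Y _ _
    refine ⟨fun _ => .done, fun _ => Nat.zero_le _, ?_⟩
    rw [expect_eq_sum_update D e]
    refine Finset.sum_le_sum fun v _ => ?_
    gcongr
    exact expect_mono fun x => hgain _ _ _ _
  -- `Y` collects the light items that `A` has already met on the current branch.
  | probe a next ih =>
    intro b D Y hb hD
    by_cases hae : a = e
    · subst hae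
      refine ⟨next, Policy.depth_next_le hb, ?_⟩
      rw [expect_shortfall_probe]
      refine Finset.sum_le_sum fun v _ => ?_
      gcongr
      -- Here `A` probes `e` itself: a light `e` moves from `Y` to `G`, so the union is the same and
      -- `|G|` does not drop.
      refine expect_mono fun x => shortfall_le_of ?_
      split_ifs
      · rw [Finset.union_insert, Finset.insert_union, Finset.insert_union, Finset.insert_union]
        gcongr
        exact Finset.subset_insert _ _
      · exact le_rfl
    -- With `b = 0` the probe of `a` is the last one allowed, and it is the one given up in exchange
    -- for `e`.
    · rcases Nat.eq_zero_or_pos b with rfl | hbpos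
      · have hdone : ∀ w, next w = .done := fun w =>
          Policy.eq_done_of_depth (Policy.depth_next_le hb w)
        refine ⟨fun _ => .done, fun _ => le_rfl, ?_⟩
        rw [expect_shortfall_probe]
        simp only [hdone, Policy.selected]
        have hl : ∀ x : Fin n → Fin (m + 1), light x t ∅ = ∅ := fun x => Finset.filter_empty _
        simp only [shortfall, hl, expect_const, Finset.union_empty]
        rcases hD a hae with h | h
        -- A spanned `a` adds no rank, so nothing is lost by dropping it.
        · have h1 : ∀ w : Fin (m + 1),
              rk M ((G ∪ (if (w : ℕ) ≤ t then insert a Y else Y) : Finset (Fin n)) : Set (Fin n))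
                = rk M ((G ∪ Y : Finset (Fin n)) : Set (Fin n)) := by
            intro w
            split_ifs
            · rw [Finset.union_insert, Finset.coe_insert]
              exact rk_insert_of_mem_closure M h
            · rfl
          simp only [h1]
          rw [← Finset.sum_mul, sum_pmf]
          refine le_of_le_of_eq (Finset.sum_le_sum fun v _ => ?_)
            ((Finset.sum_mul _ _ _).symm.trans (congrArg (· * _) (sum_pmf (D e))))
          gcongr
          simpa [shortfall, hl] using hgain Y v (fun _ => 0) ∅
        -- Otherwise a light `a` adds at most one to the rank and a light `e` adds one to `|G|`.
        -- Both lead from `w` to `u`, and `e` is at least as likely to be light.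
        · set u : ℝ≥0∞ :=
            if rk M ((G ∪ Y : Finset (Fin n)) : Set (Fin n)) + 1 + G.card + 1 < θ then 1 else 0
          set w : ℝ≥0∞ :=
            if rk M ((G ∪ Y : Finset (Fin n)) : Set (Fin n)) + G.card + 1 < θ then 1 else 0
          have huw : u ≤ w := by
            simp only [u, w]
            split_ifs <;> first | omega | simp
          calc _ ≤ ∑ v, D e v * (if (v : ℕ) ≤ t then u else w) := by
                refine Finset.sum_le_sum fun v _ => ?_
                gcongr
                by_cases hv : (v : ℕ) ≤ t
                · simp only [u, if_pos hv]
                  have h1 : rk M ((G ∪ Y : Finset (Fin n)) : Set (Fin n))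
                      ≤ rk M ((insert e G ∪ Y : Finset (Fin n)) : Set (Fin n)) := by
                    refine rk_mono M ?_
                    gcongr
                    exact Finset.subset_insert _ _
                  rw [Finset.card_insert_of_notMem heG]
                  split_ifs <;> first | omega | simp
                · simp only [if_neg hv]
                  exact le_rfl
            _ ≤ ∑ v, D a v * (if (v : ℕ) ≤ t then u else w) := by
                rw [sum_pmf_ite, sum_pmf_ite]
                exact mix_le_mix h (lawCdf_le_one D e t) huw
            _ ≤ _ := by
                refine Finset.sum_le_sum fun v _ => ?_
                gcongr
                by_cases hv : (v : ℕ) ≤ t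
                · simp only [u, if_pos hv]
                  have h1 := rk_insert_le M a ((G ∪ Y : Finset (Fin n)) : Set (Fin n))
                  rw [Finset.union_insert, Finset.coe_insert]
                  split_ifs <;> first | omega | simp
                · simp only [if_neg hv]
                  exact le_rfl
      · obtain ⟨b, rfl⟩ := Nat.exists_eq_add_of_le' hbpos
        -- With probes to spare, `a` is kept and the exchange happens further down. The hypothesis
        -- on `a` survives its observation: a light `a` joins `Y`, a heavy one has probability zero
        -- of being light.
        have key := fun w => ih w b (Function.update D a (PMF.pure w))
          (if (w : ℕ) ≤ t then insert a Y else Y) (Policy.depth_next_le hb w) (by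
            intro a' ha'
            rw [lawCdf_update_of_ne (Ne.symm hae)]
            by_cases haa : a' = a
            · subst haa
              by_cases hw : (w : ℕ) ≤ t
              · left
                rw [if_pos hw]
                exact M.mem_closure_of_mem' (by simp) (by simp [hE])
              · right
                rw [lawCdf_eq_zero_of_pure (Function.update_self ..) hw]
                exact zero_le
            · rw [lawCdf_update_of_ne haa]
              refine (hD a' ha').imp (fun h => M.closure_subset_closure ?_ h) id
              split_ifs
              · gcongr
                exact Finset.subset_insert _ _
              · exact le_rfl)
        choose f hf1 hf2 using key
        refine ⟨fun v => .probe a fun w => f w v,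
          fun v => Policy.depth_probe_le fun w => hf1 w v, ?_⟩
        rw [expect_shortfall_probe]
        refine le_trans (le_of_eq ?_)
          (Finset.sum_le_sum fun w _ => mul_le_mul_right (hf2 w) (D a w))
        simp only [expect_shortfall_probe, Finset.mul_sum]
        rw [Finset.sum_comm]
        -- Observing `a` and `e` in either order gives the same conditional laws, since `a ≠ e`.
        refine Finset.sum_congr rfl fun w _ => Finset.sum_congr rfl fun v _ => ?_
        rw [Function.update_of_ne hae, Function.update_of_ne (Ne.symm hae),
          Function.update_comm hae, mul_left_comm]

end Exchange

/-! ### Thresholds, phases and charging -/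

/-- The thresholds `0, 1, 2, 4, 8, …`. -/
def threshold (a : ℕ) : ℕ := if a = 0 then 0 else 2 ^ (a - 1)

theorem threshold_succ (a : ℕ) : threshold (a + 1) = 2 ^ a := by simp [threshold]

/-- The `a`-th threshold, and `∞` beyond the `L`-th. -/
def price (L a : ℕ) : ℝ≥0∞ := if a ≤ L then (threshold a : ℝ≥0∞) else ⊤

/-- If `a` is the largest contributing index and `a ≥ 1`, then `2 ^ (a - 1) < v`, and the geometric
sum is below `2 ^ (a + 1) < 4 * v`. -/
theorem sum_two_pow_ite_le (v N : ℕ) :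
    ∑ a ∈ Finset.range N, (if threshold a < v then 2 ^ a else 0) ≤ 4 * v := by
  induction N with
  | zero => simp
  | succ N ih =>
    rw [Finset.sum_range_succ]
    split_ifs with h
    · have h1 : ∑ a ∈ Finset.range N, (if threshold a < v then 2 ^ a else 0)
          ≤ ∑ a ∈ Finset.range N, 2 ^ a :=
        Finset.sum_le_sum fun a _ => by split_ifs <;> simp
      have h2 : ∑ a ∈ Finset.range N, 2 ^ a < 2 ^ N :=
        Nat.geomSum_lt le_rfl (by simp)
      rcases N with _ | N
      · simp [threshold] at h ⊢
        omega
      · rw [threshold_succ] at h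
        rw [pow_succ] at h2 ⊢
        omega
    · simpa using ih

theorem sum_price_le {L v : ℕ} (hv : v ≤ threshold L) :
    ∑ a ∈ Finset.range (L + 1), price L (a + 1) * (if threshold a < v then 1 else 0)
      ≤ 4 * (v : ℝ≥0∞) := by
  have h := sum_two_pow_ite_le v L
  -- The term `a = L` has infinite price, but its indicator vanishes because no weight exceeds the
  -- last threshold.
  rw [Finset.sum_range_succ, if_neg (not_lt.2 hv), mul_zero, add_zero]
  refine le_trans (le_of_eq ?_) (by exact_mod_cast h : ((_ : ℕ) : ℝ≥0∞) ≤ _)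
  rw [Nat.cast_sum]
  refine Finset.sum_congr rfl fun a ha => ?_
  rw [price, if_pos (Nat.succ_le_of_lt (Finset.mem_range.1 ha)), threshold_succ]
  split_ifs <;> simp

/-- The number of basis elements to be added in a phase which starts `D` elements short. -/
def quota (D : ℕ) : ℕ := D / 4 + 1

/-- The number of elements, over all phases from the deficiency `D` on, that are charged to a set of
deficiency `d`. -/
def charge (D d : ℕ) : ℕ :=
  if D = 0 then 0
  else (if D + 2 - 2 * quota D ≤ d then quota D else 0) + charge (D - quota D) d
termination_by D
decreasing_by simp only [quota]; omega

/-- The number of phases from the deficiency `D` on. -/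
def phases (D : ℕ) : ℕ :=
  if D = 0 then 0 else phases (D - quota D) + 1
termination_by D
decreasing_by simp only [quota]; omega

theorem charge_zero (d : ℕ) : charge 0 d = 0 := by rw [charge]; simp

theorem charge_of_pos {D : ℕ} (h : D ≠ 0) (d : ℕ) : charge D d
    = (if D + 2 - 2 * quota D ≤ d then quota D else 0) + charge (D - quota D) d := by
  rw [charge, if_neg h]

theorem phases_zero : phases 0 = 0 := by rw [phases]; simp

theorem phases_of_pos {D : ℕ} (h : D ≠ 0) : phases D = phases (D - quota D) + 1 := by
  rw [phases, if_neg h]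

theorem phases_le_self (D : ℕ) : phases D ≤ D := by
  induction D using Nat.strong_induction_on with
  | _ D ih =>
    by_cases h : D = 0
    · simp [h, phases_zero]
    · rw [phases_of_pos h]
      have := ih (D - quota D) (by simp only [quota]; omega)
      simp only [quota] at this ⊢
      omega

theorem charge_le_self (D d : ℕ) : charge D d ≤ D := by
  induction D using Nat.strong_induction_on with
  | _ D ih =>
    by_cases h : D = 0
    · simp [h, charge_zero]
    · rw [charge_of_pos h]
      have := ih (D - quota D) (by simp only [quota]; omega)
      have hq : quota D ≤ D := by simp only [quota]; omega
      split_ifs <;> omega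

/-- In the first phase that is charged, `D / 2 ≤ D + 2 - 2 * quota D ≤ d`. From then on at most `D ≤
2 * d` elements are added altogether. -/
theorem charge_le_two_mul (D d : ℕ) : charge D d ≤ 2 * d := by
  induction D using Nat.strong_induction_on with
  | _ D ih =>
    by_cases h : D = 0
    · simp [h, charge_zero]
    · have h1 := charge_le_self D d
      have h2 := ih (D - quota D) (by simp only [quota]; omega)
      rw [charge_of_pos h] at h1 ⊢
      split_ifs at h1 ⊢ with hd
      · simp only [quota] at h1 h2 hd ⊢
        omega
      · omega

/-- How much the rank of the items of `S` of weight at most `t` falls short of `k`. -/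
def deficit (M : Matroid (Fin n)) (k t : ℕ) (x : Fin n → Fin (m + 1)) (S : Finset (Fin n)) : ℕ :=
  k - rk M ((light x t S : Finset (Fin n)) : Set (Fin n))

/-- The light elements of the basis `T` are independent, and the remaining ones among its `k`
elements are heavy. -/
theorem deficit_le_card {M : Matroid (Fin n)} {k : ℕ} (hk : M.eRank = (k : ℕ∞))
    {T S : Finset (Fin n)} (hTS : T ⊆ S) (hT : M.IsBase (T : Set (Fin n))) (t : ℕ)
    (x : Fin n → Fin (m + 1)) :
    deficit M k t x S ≤ (T.filter fun e => t < (x e : ℕ)).card := by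
  have h1 : T.card = k := by
    have := hT.encard_eq_eRank
    rw [hk, Set.encard_coe_eq_coe_finsetCard] at this
    exact_mod_cast this
  have h2 : (light x t T).card ≤ rk M ((light x t S : Finset (Fin n)) : Set (Fin n)) := by
    refine card_le_rk M (hT.indep.subset ?_) ?_
    · exact_mod_cast Finset.filter_subset _ _
    · exact_mod_cast Finset.filter_subset_filter _ hTS
  have h3 := Finset.card_filter_add_card_filter_not (s := T) (fun e => (x e : ℕ) ≤ t)
  simp only [not_le] at h3
  simp only [deficit, light] at h2 ⊢
  omega

/-- The source of the factor `8`: a factor `2` from charging and a factor `4` from the geometric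
thresholds. For each basis in `S`, the double sum over thresholds and elements is exchanged. -/
theorem Instance.sum_price_mul_charge_le (I : Instance n m) {k L : ℕ}
    (hk : I.M.eRank = (k : ℕ∞)) (hL : m ≤ threshold L) (x : Fin n → Fin (m + 1))
    (S : Finset (Fin n)) :
    ∑ a ∈ Finset.range (L + 1),
        price L (a + 1) * (charge k (deficit I.M k (threshold a) x S) : ℝ≥0∞)
      ≤ 8 * I.objective x S := by
  rw [Instance.objective, ENNReal.mul_iInf_of_ne (by norm_num) (by norm_num)]
  refine le_iInf fun T => ?_
  obtain ⟨T, hTS, hT⟩ := T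
  calc ∑ a ∈ Finset.range (L + 1),
        price L (a + 1) * (charge k (deficit I.M k (threshold a) x S) : ℝ≥0∞)
      ≤ ∑ a ∈ Finset.range (L + 1),
          2 * ∑ e ∈ T, price L (a + 1) * (if threshold a < (x e : ℕ) then 1 else 0) := by
        refine Finset.sum_le_sum fun a _ => ?_
        rw [← Finset.mul_sum, mul_left_comm]
        gcongr
        have := (charge_le_two_mul k _).trans
          (Nat.mul_le_mul_left 2 (deficit_le_card hk hTS hT (threshold a) x))
        rw [Finset.card_filter] at this
        exact_mod_cast this
    _ = 2 * ∑ e ∈ T, ∑ a ∈ Finset.range (L + 1),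
          price L (a + 1) * (if threshold a < (x e : ℕ) then 1 else 0) := by
        rw [← Finset.mul_sum, Finset.sum_comm]
    _ ≤ 2 * ∑ e ∈ T, 4 * ((x e : ℕ) : ℝ≥0∞) := by
        gcongr with e _
        exact sum_price_le ((Nat.lt_succ_iff.1 (x e).isLt).trans hL)
    _ = 8 * ∑ e ∈ T, ((x e : ℕ) : ℝ≥0∞) := by
        rw [← Finset.mul_sum, ← mul_assoc]
        norm_num

/-! ### Logarithmic bounds for the numbers of phases and tests -/

/-- A phase leaves at most three quarters of the deficiency, and `log (3 / 4) ≤ -1 / 4`, so `4 * log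
D` drops by at least one per phase. -/
theorem phases_le_log (D : ℕ) (hD : 1 ≤ D) : (phases D : ℝ) ≤ 1 + 4 * Real.log D := by
  induction D using Nat.strong_induction_on with
  | _ D ih =>
    have hlog : 0 ≤ Real.log D := Real.log_natCast_nonneg D
    rw [phases_of_pos (by omega)]
    by_cases h : D - quota D = 0
    · rw [h, phases_zero]
      push_cast
      linarith
    · have h1 := ih (D - quota D) (by simp only [quota]; omega) (by omega)
      have h2 : ((D - quota D : ℕ) : ℝ) ≤ 3 / 4 * D := by
        have : 4 * (D - quota D) ≤ 3 * D := by simp only [quota]; omega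
        have : (4 : ℝ) * ((D - quota D : ℕ) : ℝ) ≤ 3 * D := by exact_mod_cast this
        linarith
      have hpos : (0 : ℝ) < ((D - quota D : ℕ) : ℝ) := by exact_mod_cast Nat.pos_of_ne_zero h
      have hDpos : (0 : ℝ) < D := by exact_mod_cast hD
      have h3 := Real.log_le_log hpos h2
      rw [Real.log_mul (by norm_num) hDpos.ne'] at h3
      have h4 : Real.log (3 / 4) ≤ 3 / 4 - 1 := Real.log_le_sub_one_of_pos (by norm_num)
      push_cast
      linarith

theorem phases_le (D : ℕ) : (phases D : ℝ) ≤ 5 * max 1 (Real.log D) := by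
  rcases Nat.eq_zero_or_pos D with rfl | h
  · rw [phases_zero]
    simp
  · have h1 := phases_le_log D h
    have h2 := le_max_left 1 (Real.log D)
    have h3 := le_max_right 1 (Real.log D)
    linarith

theorem size_le_log (l : ℕ) (hl : 1 ≤ l) : (Nat.size l : ℝ) ≤ 1 + 2 * Real.log l := by
  have h1 : Nat.size l = Nat.log 2 l + 1 := by
    refine le_antisymm ?_ ?_
    · exact Nat.size_le.2 (Nat.lt_pow_succ_log_self (by norm_num) l)
    · exact Nat.lt_size.2 (Nat.pow_log_le_self 2 (by omega))
  have h2 : ((2 ^ Nat.log 2 l : ℕ) : ℝ) ≤ l := by exact_mod_cast Nat.pow_log_le_self 2 (by omega)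
  have h3 := Real.log_le_log (by positivity) h2
  rw [Nat.cast_pow, Real.log_pow] at h3
  have h4 : (1 / 2 : ℝ) ≤ Real.log 2 := by
    have := Real.log_two_gt_d9
    linarith
  have h5 : ((Nat.log 2 l : ℕ) : ℝ) * (1 / 2) ≤ (Nat.log 2 l : ℕ) * Real.log 2 := by gcongr
  rw [h1]
  push_cast at h3 ⊢
  linarith

/-- With `y = max 1 (log m)`, `L + 1 ≤ 5 * y`. Since `log 5 ≤ 4`, the size is at most `1 + 2 * (4 +
log y)`, whence the constant `11`. -/
theorem size_le (m L : ℕ) (hL : L ≤ Nat.log 2 m + 2) :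
    (Nat.size (L + 1) : ℝ) ≤ 11 * max 1 (Real.log (Real.log m)) := by
  have h1 := size_le_log (L + 1) (by omega)
  set y := max 1 (Real.log m) with hy
  have hy1 : 1 ≤ y := le_max_left _ _
  have h2 : ((Nat.log 2 m : ℕ) : ℝ) ≤ 2 * y := by
    rcases Nat.eq_zero_or_pos m with rfl | hm
    · simp only [Nat.log_zero_right, Nat.cast_zero]
      linarith
    · have h2 : ((2 ^ Nat.log 2 m : ℕ) : ℝ) ≤ m := by
        exact_mod_cast Nat.pow_log_le_self 2 (by omega)
      have h3 := Real.log_le_log (by positivity) h2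
      rw [Nat.cast_pow, Real.log_pow] at h3
      have h4 : (1 / 2 : ℝ) ≤ Real.log 2 := by
        have := Real.log_two_gt_d9
        linarith
      have h5 : ((Nat.log 2 m : ℕ) : ℝ) * (1 / 2) ≤ (Nat.log 2 m : ℕ) * Real.log 2 := by gcongr
      have h6 : Real.log m ≤ y := le_max_right _ _
      push_cast at h3
      linarith
  have h3 : ((L + 1 : ℕ) : ℝ) ≤ 5 * y := by
    have : (L : ℝ) ≤ (Nat.log 2 m : ℕ) + 2 := by exact_mod_cast hL
    push_cast
    linarith
  have h4 := Real.log_le_log (by positivity) h3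
  rw [Real.log_mul (by norm_num) (by positivity)] at h4
  have h5 : Real.log 5 ≤ 5 - 1 := Real.log_le_sub_one_of_pos (by norm_num)
  have h6 : Real.log y ≤ max 1 (Real.log (Real.log m)) := by
    rcases le_total (Real.log m) 1 with h | h
    · rw [hy, max_eq_left h, Real.log_one]
      exact zero_le_one.trans (le_max_left _ _)
    · rw [hy, max_eq_right h]
      exact le_max_right _ _
  have h7 := le_max_left 1 (Real.log (Real.log m))
  linarith

/-- A set of at most `N * B` elements is a union of `N` sets of at most `B` elements. -/
theorem exists_biUnion_card_le {α : Type*} [DecidableEq α] (B N : ℕ) :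
    ∀ S : Finset α, S.card ≤ N * B →
      ∃ F : Fin N → Finset α, (∀ j, (F j).card ≤ B) ∧ S = Finset.univ.biUnion F := by
  induction N with
  | zero =>
    intro S hS
    exact ⟨fun _ => ∅, fun j => j.elim0, by simpa using hS⟩
  | succ N ih =>
    intro S hS
    obtain ⟨R, hRS, hR⟩ := Finset.exists_subset_card_eq (min_le_right B S.card)
    obtain ⟨F, hF1, hF2⟩ := ih (S \ R) (by
      rw [Finset.card_sdiff_of_subset hRS, hR]
      rw [add_mul] at hS
      omega)
    refine ⟨Fin.cons R F, fun j => ?_, ?_⟩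
    · refine Fin.cases ?_ (fun j => ?_) j
      · simp [hR]
      · simpa using hF1 j
    · ext a
      have := Finset.ext_iff.1 hF2 a
      simp only [Finset.mem_sdiff, Finset.mem_biUnion, Finset.mem_univ, true_and] at this ⊢
      rw [Fin.exists_fin_succ]
      simp only [Fin.cons_zero, Fin.cons_succ, ← this]
      have := @hRS a
      tauto

/-! ### Reasoning about programs -/

theorem Memory.write_apply (s : Memory) (a i v a' i' : ℕ) :
    s.write a i v a' i' = if a' = a ∧ i' = i then v else s a' i' := rfl

@[simp]
theorem Memory.write_self (s : Memory) (a i v : ℕ) : s.write a i v a i = v := by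
  simp [Memory.write_apply]

@[simp]
theorem Memory.write_of_ne (s : Memory) {a a' : ℕ} (h : a' ≠ a) (i v : ℕ) :
    s.write a i v a' = s a' := by
  funext i'
  simp [Memory.write_apply, h]

@[simp]
theorem Memory.write_of_ne_index (s : Memory) (a : ℕ) {i i' : ℕ} (h : i' ≠ i) (v : ℕ) :
    s.write a i v a i' = s a i' := by
  simp [Memory.write_apply, h]

/-- The arrays that a program may change. -/
def Program.writes : Program → List ℕ
  | .skip => []
  | .assign a _ _ => [a]
  | .seq c d => c.writes ++ d.writes
  | .ifThenElse _ c d => c.writes ++ d.writes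
  | .while _ c => c.writes
  | .indep _ r => [r]
  | .compare _ _ _ r => [r]
  | .probe _ r => [r]

open Classical in
/-- `Big I c s T s'`: from the memory `s`, the program `c` makes no probes and finishes after exactly
`T` steps with the memory `s'`. -/
inductive Big (I : Instance n m) : Program → Memory → ℕ → Memory → Prop where
  | skip (s : Memory) : Big I .skip s 1 s
  | assign (a : ℕ) (i p : Expr) (s : Memory) :
      Big I (.assign a i p) s 1 (s.write a (i.eval s) (p.eval s))
  | seq {c d : Program} {s s' s'' : Memory} {T T' : ℕ} (hc : Big I c s T s')
      (hd : Big I d s' T' s'') : Big I (.seq c d) s (T + T' + 1) s''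
  | ite_true {b : Expr} {c d : Program} {s s' : Memory} {T : ℕ} (hb : b.eval s ≠ 0)
      (hc : Big I c s T s') : Big I (.ifThenElse b c d) s (T + 1) s'
  | ite_false {b : Expr} {c d : Program} {s s' : Memory} {T : ℕ} (hb : b.eval s = 0)
      (hd : Big I d s T s') : Big I (.ifThenElse b c d) s (T + 1) s'
  | while_true {b : Expr} {c : Program} {s s' s'' : Memory} {T T' : ℕ} (hb : b.eval s ≠ 0)
      (hc : Big I c s T s') (hw : Big I (.while b c) s' T' s'') :
      Big I (.while b c) s (T + T' + 1) s''
  | while_false {b : Expr} {c : Program} {s : Memory} (hb : b.eval s = 0) :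
      Big I (.while b c) s 1 s
  | indep (a r : ℕ) (s : Memory) : Big I (.indep a r) s 1
      (s.write r 0 (if I.M.Indep {e : Fin n | s a e ≠ 0} then 1 else 0))
  | compare (p q t : Expr) (r : ℕ) (s : Memory) : Big I (.compare p q t r) s 1
      (s.write r 0 (if ∃ (hp : p.eval s < n) (hq : q.eval s < n),
        I.cdf ⟨p.eval s, hp⟩ (t.eval s) ≤ I.cdf ⟨q.eval s, hq⟩ (t.eval s) then 1 else 0))

theorem Big.frame {I : Instance n m} {c : Program} {s s' : Memory} {T : ℕ} (h : Big I c s T s') :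
    ∀ a, a ∉ c.writes → s' a = s a := by
  induction h with
  | skip s => exact fun _ _ => rfl
  | assign a i p s =>
    intro a' h
    simp only [Program.writes, List.mem_singleton] at h
    exact s.write_of_ne h _ _
  | seq _ _ ih1 ih2 =>
    intro a h
    simp only [Program.writes, List.mem_append, not_or] at h
    rw [ih2 a h.2, ih1 a h.1]
  | ite_true _ _ ih =>
    intro a h
    simp only [Program.writes, List.mem_append, not_or] at h
    exact ih a h.1
  | ite_false _ _ ih =>
    intro a h
    simp only [Program.writes, List.mem_append, not_or] at h
    exact ih a h.2
  | while_true _ _ _ ih1 ih2 =>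
    intro a h
    rw [ih2 a h]
    exact ih1 a h
  | while_false _ => exact fun _ _ => rfl
  | indep a r s =>
    intro a' h
    simp only [Program.writes, List.mem_singleton] at h
    exact s.write_of_ne h _ _
  | compare p q t r s =>
    intro a' h
    simp only [Program.writes, List.mem_singleton] at h
    exact s.write_of_ne h _ _

theorem Runs.mono {I : Instance n m} {T : ℕ} {c : Config} {π : Policy n m} (h : Runs I T c π) :
    ∀ {T' : ℕ}, T ≤ T' → Runs I T' c π := by
  induction h with
  | halt h => exact fun _ => .halt h
  | move h _ ih =>
    intro T' hT
    obtain ⟨T', rfl⟩ := Nat.exists_eq_add_of_le' (Nat.one_le_of_lt hT)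
    exact .move h (ih (by omega))
  | probe h _ ih =>
    intro T' hT
    obtain ⟨T', rfl⟩ := Nat.exists_eq_add_of_le' (Nat.one_le_of_lt hT)
    exact .probe h fun v => ih v (by omega)

/-- The transition function is deterministic apart from the observed weights. This identifies the
policies obtained from analyses against different competitors. -/
theorem Runs.unique {I : Instance n m} {T : ℕ} {c : Config} {π : Policy n m}
    (h : Runs I T c π) : ∀ {T' : ℕ} {π' : Policy n m}, Runs I T' c π' → π = π' := by
  induction h with
  | halt h =>
    intro T' π' h'
    cases h' with
    | halt _ => rfl
    | move h' _ => rw [h] at h'; cases h'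
    | probe h' _ => rw [h] at h'; cases h'
  | move h _ ih =>
    intro T' π' h'
    cases h' with
    | halt h' => rw [h] at h'; cases h'
    | move h' hr => rw [h] at h'; cases h'; exact ih hr
    | probe h' _ => rw [h] at h'; cases h'
  | probe h _ ih =>
    intro T' π' h'
    cases h' with
    | halt h' => rw [h] at h'; cases h'
    | move h' _ => rw [h] at h'; cases h'
    | probe h' hr =>
      rw [h] at h'
      cases h'
      congr 1
      funext v
      exact ih v (hr v)

theorem Big.runs {I : Instance n m} {c : Program} {s s' : Memory} {T : ℕ} (h : Big I c s T s') :
    ∀ {K : List Program} {T' : ℕ} {π : Policy n m}, Runs I T' ⟨K, s'⟩ π →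
      Runs I (T + T') ⟨c :: K, s⟩ π := by
  induction h with
  | skip s => exact fun h => (Runs.move rfl h).mono (by omega)
  | assign a i p s => exact fun h => (Runs.move rfl h).mono (by omega)
  | seq _ _ ih1 ih2 => exact fun h => (Runs.move rfl (ih1 (ih2 h))).mono (by omega)
  | ite_true hb _ ih =>
    intro K T' π h
    refine (Runs.move ?_ (ih h)).mono (le_of_eq (by omega))
    simp only [Config.action, if_pos hb]
  | ite_false hb _ ih =>
    intro K T' π h
    refine (Runs.move ?_ (ih h)).mono (le_of_eq (by omega))
    simp only [Config.action, hb, ne_eq, not_true_eq_false, if_false]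
  | while_true hb _ _ ih1 ih2 =>
    intro K T' π h
    refine (Runs.move ?_ (ih1 (ih2 h))).mono (le_of_eq (by omega))
    simp only [Config.action, if_pos hb]
  | while_false hb =>
    intro K T' π h
    refine (Runs.move ?_ h).mono (le_of_eq (by omega))
    simp only [Config.action, hb, ne_eq, not_true_eq_false, if_false]
  | indep a r s => exact fun h => (Runs.move rfl h).mono (by omega)
  | compare p q t r s => exact fun h => (Runs.move rfl h).mono (by omega)

/-! ### Rules for programs without probes -/

/-- From the memory `s`, the program `c` finishes within `T` steps, without probes, in a memory that
satisfies `Q`. -/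
def Det (I : Instance n m) (c : Program) (s : Memory) (T : ℕ) (Q : Memory → Prop) : Prop :=
  ∃ s' T', T' ≤ T ∧ Big I c s T' s' ∧ Q s'

theorem Det.mono {I : Instance n m} {c : Program} {s : Memory} {T T' : ℕ} {Q Q' : Memory → Prop}
    (h : Det I c s T Q) (hT : T ≤ T') (hQ : ∀ s', Q s' → Q' s') : Det I c s T' Q' := by
  obtain ⟨s', T0, h1, h2, h3⟩ := h
  exact ⟨s', T0, h1.trans hT, h2, hQ s' h3⟩

theorem Det.frame {I : Instance n m} {c : Program} {s : Memory} {T : ℕ} {Q : Memory → Prop}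
    (h : Det I c s T Q) : Det I c s T fun s' => Q s' ∧ ∀ a, a ∉ c.writes → s' a = s a := by
  obtain ⟨s', T0, h1, h2, h3⟩ := h
  exact ⟨s', T0, h1, h2, h3, h2.frame⟩

theorem Det.assign {I : Instance n m} {a : ℕ} {i p : Expr} {s : Memory} {Q : Memory → Prop}
    (h : Q (s.write a (i.eval s) (p.eval s))) : Det I (.assign a i p) s 1 Q :=
  ⟨_, 1, le_rfl, Big.assign .., h⟩

theorem Det.seq {I : Instance n m} {c d : Program} {s : Memory} {T T' : ℕ} {Q : Memory → Prop}
    (h : Det I c s T fun s' => Det I d s' T' Q) : Det I (.seq c d) s (T + T' + 1) Q := by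
  obtain ⟨s', T1, h1, h2, s'', T2, h4, h5, h6⟩ := h
  exact ⟨s'', T1 + T2 + 1, by omega, h2.seq h5, h6⟩

theorem Det.ite {I : Instance n m} {b : Expr} {c d : Program} {s : Memory} {T : ℕ}
    {Q : Memory → Prop} (hc : b.eval s ≠ 0 → Det I c s T Q) (hd : b.eval s = 0 → Det I d s T Q) :
    Det I (.ifThenElse b c d) s (T + 1) Q := by
  by_cases hb : b.eval s = 0
  · obtain ⟨s', T1, h1, h2, h3⟩ := hd hb
    exact ⟨s', T1 + 1, by omega, .ite_false hb h2, h3⟩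
  · obtain ⟨s', T1, h1, h2, h3⟩ := hc hb
    exact ⟨s', T1 + 1, by omega, .ite_true hb h2, h3⟩

/-- The number of steps of a program without loops. -/
def Program.cost : Program → ℕ
  | .seq c d => c.cost + d.cost + 1
  | .ifThenElse _ c d => max c.cost d.cost + 1
  | _ => 1

/-- The weakest precondition of a program without loops and probes. -/
def wp (I : Instance n m) : Program → Memory → (Memory → Prop) → Prop
  | .skip, s, Q => Q s
  | .assign a i p, s, Q => Q (s.write a (i.eval s) (p.eval s))
  | .seq c d, s, Q => wp I c s fun s' => wp I d s' Q
  | .ifThenElse b c d, s, Q => (b.eval s ≠ 0 → wp I c s Q) ∧ (b.eval s = 0 → wp I d s Q)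
  | .while _ _, _, _ => False
  | .indep a r, s, Q => (I.M.Indep {e : Fin n | s a e ≠ 0} → Q (s.write r 0 1)) ∧
      (¬ I.M.Indep {e : Fin n | s a e ≠ 0} → Q (s.write r 0 0))
  | .compare p q t r, s, Q =>
      ((∃ (hp : p.eval s < n) (hq : q.eval s < n),
        I.cdf ⟨p.eval s, hp⟩ (t.eval s) ≤ I.cdf ⟨q.eval s, hq⟩ (t.eval s)) →
          Q (s.write r 0 1)) ∧
      ((¬ ∃ (hp : p.eval s < n) (hq : q.eval s < n),
        I.cdf ⟨p.eval s, hp⟩ (t.eval s) ≤ I.cdf ⟨q.eval s, hq⟩ (t.eval s)) →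
          Q (s.write r 0 0))
  | .probe _ _, _, _ => False

/-- Straight-line code is verified by unfolding `wp`; only loops and probes need rules of their own.
-/
theorem Det.of_wp {I : Instance n m} :
    ∀ {c : Program} {s : Memory} {Q : Memory → Prop}, wp I c s Q → Det I c s c.cost Q
  | .skip, _, _, h => ⟨_, 1, le_rfl, .skip _, h⟩
  | .assign _ _ _, _, _, h => .assign h
  | .seq c d, _, Q, h =>
    .seq ((Det.of_wp (c := c) (Q := fun s' => wp I d s' Q) h).mono le_rfl
      fun _ h' => Det.of_wp h')
  | .ifThenElse _ _ _, _, _, h =>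
    .ite (fun hb => (Det.of_wp (h.1 hb)).mono (le_max_left _ _) fun _ => id)
      (fun hb => (Det.of_wp (h.2 hb)).mono (le_max_right _ _) fun _ => id)
  | .while _ _, _, _, h => h.elim
  | .indep a r, s, _, h => by
    refine ⟨_, 1, le_rfl, .indep a r s, ?_⟩
    split_ifs with h1
    · exact h.1 h1
    · exact h.2 h1
  | .compare p q t r, s, _, h => by
    refine ⟨_, 1, le_rfl, .compare p q t r s, ?_⟩
    split_ifs with h1
    · exact h.1 h1
    · exact h.2 h1
  | .probe _ _, _, _, h => h.elim

/-- The scalar variable `a`. -/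
abbrev var (a : ℕ) : Expr := .read a (.const 0)

/-- The entry of array `a` at the index given by the scalar variable `8`. -/
abbrev cell (a : ℕ) : Expr := .read a (var 8)

/-- The loop over all items, with loop variable `8`. -/
def forItems (body : Program) : Program :=
  .seq (.assign 8 (.const 0) (.const 0))
    (.while (.sub (var 0) (var 8))
      (.seq body (.assign 8 (.const 0) (.add (var 8) (.const 1)))))

/-- Each pass costs three steps besides the body: the test of the guard, the sequencing and the
increment. The final `3` pays for the initialisation, the outer sequencing and the last test. -/
theorem Det.forItems {I : Instance n m} {body : Program} {s : Memory} {T : ℕ}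
    (Inv : ℕ → Memory → Prop) (hn : s 0 0 = n) (hw0 : 0 ∉ body.writes) (hw8 : 8 ∉ body.writes)
    (h0 : Inv 0 (s.write 8 0 0))
    (hstep : ∀ j, j < n → ∀ s', s' 8 0 = j → (∀ a, a ∉ body.writes → a ≠ 8 → s' a = s a) →
      Inv j s' → Det I body s' T fun s'' => Inv (j + 1) (s''.write 8 0 (j + 1))) :
    Det I (forItems body) s (n * (T + 3) + 3)
      fun s' => Inv n s' ∧ ∀ a, a ∉ body.writes → a ≠ 8 → s' a = s a := by
  have hloop : ∀ i j s', j + i = n → s' 8 0 = j → (∀ a, a ∉ body.writes → a ≠ 8 → s' a = s a) →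
      Inv j s' → Det I (.while (.sub (var 0) (var 8))
        (.seq body (.assign 8 (.const 0) (.add (var 8) (.const 1))))) s' (i * (T + 3) + 1)
        fun s' => Inv n s' ∧ ∀ a, a ∉ body.writes → a ≠ 8 → s' a = s a := by
    intro i
    induction i with
    | zero =>
      intro j s' hj h8 hf hI
      have h00 : s' 0 0 = n := by rw [hf 0 hw0 (by norm_num), hn]
      obtain rfl : j = n := by omega
      exact ⟨s', 1, by omega, .while_false (by simp [Expr.eval, h00, h8]), hI, hf⟩
    | succ i ih =>
      intro j s' hj h8 hf hI
      have h00 : s' 0 0 = n := by rw [hf 0 hw0 (by norm_num), hn]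
      obtain ⟨s1, T1, hT1, hb1, hQ1, hf1⟩ := (hstep j (by omega) s' h8 hf hI).frame
      have h81 : s1 8 0 = j := by rw [hf1 8 hw8, h8]
      obtain ⟨s2, T2, hT2, hb2, hQ2⟩ := ih (j + 1) (s1.write 8 0 (j + 1)) (by omega) (by simp)
        (fun a ha ha8 => by rw [Memory.write_of_ne _ ha8, hf1 a ha, hf a ha ha8]) hQ1
      refine ⟨s2, (T1 + 1 + 1) + T2 + 1, ?_, .while_true ?_ (.seq hb1 (.assign ..)) ?_, hQ2⟩
      · rw [add_mul]
        omega
      · simp only [Expr.eval, h00, h8]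
        omega
      · simpa [Expr.eval, h81] using hb2
  obtain ⟨s', T', hT', hb', hQ'⟩ := hloop n 0 (s.write 8 0 0) (by simp) (by simp)
    (fun a _ ha8 => by rw [Memory.write_of_ne _ ha8]) h0
  exact ⟨s', 1 + T' + 1, by omega, .seq (.assign ..) hb', hQ'⟩

/-- `Achieves I T b c D Z r`: from the configuration `c` the machine halts within `T` steps and
probes at most `b` items; if the weights have the laws `D` and the items of `Z` have been probed before,
then the expected objective value in the end is at most `r`. -/
def Achieves (I : Instance n m) (T b : ℕ) (c : Config) (D : Fin n → PMF (Fin (m + 1)))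
    (Z : Finset (Fin n)) (r : ℝ≥0∞) : Prop :=
  ∃ π : Policy n m, Runs I T c π ∧ (∀ x, (π.selected x).card ≤ b) ∧
    expect D (fun x => I.objective x (Z ∪ π.selected x)) ≤ r

section Achieves

variable {I : Instance n m} {T T' b b' : ℕ} {K : List Program} {s : Memory}
  {D : Fin n → PMF (Fin (m + 1))} {Z : Finset (Fin n)} {r r' : ℝ≥0∞}

theorem Achieves.mono {c : Config} (h : Achieves I T b c D Z r) (hT : T ≤ T') (hb : b ≤ b')
    (hr : r ≤ r') : Achieves I T' b' c D Z r' := by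
  obtain ⟨π, h1, h2, h3⟩ := h
  exact ⟨π, h1.mono hT, fun x => (h2 x).trans hb, h3.trans hr⟩

theorem Achieves.halt (h : expect D (fun x => I.objective x Z) ≤ r) :
    Achieves I T b ⟨[], s⟩ D Z r :=
  ⟨.done, .halt rfl, fun _ => by simp [Policy.selected], by simpa [Policy.selected] using h⟩

theorem Achieves.move {c c' : Config} (hc : c.action I = .move c')
    (h : Achieves I T b c' D Z r) : Achieves I (T + 1) b c D Z r := by
  obtain ⟨π, h1, h2, h3⟩ := h
  exact ⟨π, .move hc h1, h2, h3⟩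

theorem Achieves.det {c : Program} {Q : Memory → Prop} (hc : Det I c s T Q)
    (h : ∀ s', Q s' → Achieves I T' b ⟨K, s'⟩ D Z r) :
    Achieves I (T + T') b ⟨c :: K, s⟩ D Z r := by
  obtain ⟨s', T0, hT0, hbig, hQ⟩ := hc
  obtain ⟨π, h1, h2, h3⟩ := h s' hQ
  exact ⟨π, (hbig.runs h1).mono (by omega), h2, h3⟩

theorem Achieves.seq {c d : Program} (h : Achieves I T b ⟨c :: d :: K, s⟩ D Z r) :
    Achieves I (T + 1) b ⟨.seq c d :: K, s⟩ D Z r :=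
  .move rfl h

theorem Achieves.while_true {g : Expr} {c : Program} (hg : g.eval s ≠ 0)
    (h : Achieves I T b ⟨c :: .while g c :: K, s⟩ D Z r) :
    Achieves I (T + 1) b ⟨.while g c :: K, s⟩ D Z r := by
  refine .move ?_ h
  simp only [Config.action, if_pos hg]

theorem Achieves.while_false {g : Expr} {c : Program} (hg : g.eval s = 0)
    (h : Achieves I T b ⟨K, s⟩ D Z r) : Achieves I (T + 1) b ⟨.while g c :: K, s⟩ D Z r := by
  refine .move ?_ h
  simp only [Config.action, hg, ne_eq, not_true_eq_false, if_false]

/-- The tower rule: a bound for each observation, under the law conditioned on it, averages to a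
bound before the probe. -/
theorem Achieves.probe {p : Expr} {a : ℕ} {e : Fin n} {ρ : Fin (m + 1) → ℝ≥0∞}
    (he : p.eval s = e)
    (h : ∀ v : Fin (m + 1), Achieves I T b ⟨K, s.write a 0 v⟩
      (Function.update D e (PMF.pure v)) (insert e Z) (ρ v)) :
    Achieves I (T + 1) (b + 1) ⟨.probe p a :: K, s⟩ D Z (∑ v, D e v * ρ v) := by
  choose π h1 h2 h3 using h
  refine ⟨.probe e π, .probe (next := fun v => ⟨K, s.write a 0 v⟩) ?_ h1, fun x => ?_, ?_⟩
  · have hlt : p.eval s < n := he ▸ e.isLt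
    have hee : (⟨p.eval s, hlt⟩ : Fin n) = e := Fin.ext he
    simp only [Config.action, dif_pos hlt, hee]
  · exact (Finset.card_insert_le _ _).trans (Nat.succ_le_succ (h2 (x e) x))
  · rw [expect_eq_sum_update D e]
    refine Finset.sum_le_sum fun v _ => ?_
    gcongr
    refine le_of_eq_of_le (expect_congr_of_support fun x hx => ?_) (h3 v)
    rw [Policy.selected, eq_of_update_pure_ne_zero hx, Finset.union_insert, Finset.insert_union]

end Achieves

/-! ### Programs for sets of items

Scalar variables are arrays of which only the entry `0` is used. The allocation is:
`1` the deficiency; `2` the independent set chosen so far; `3` its extension under test; `4` the last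
successful extension; `5` the weights of the probed items, plus one; `6` the thresholds; `7` the index of the
last threshold; `8` the loop variable; `9` answers of oracles; `10` the quota; `11`, `12` the ends of the
search interval; `13` the current threshold; `14` the number of missing elements; `15` the number
of remaining probes; `16` the next item to probe; `17` the middle of the search interval. -/

/-- An expression that is nonzero if and only if both `p` and `q` are. -/
def both (p q : Expr) : Expr := .sub p (.sub p q)

theorem eval_both (p q : Expr) (s : Memory) :
    (both p q).eval s = p.eval s - (p.eval s - q.eval s) := rfl

/-- The array `a` marks the items of `S`. -/
def Marks (s : Memory) (a : ℕ) (S : Finset (Fin n)) : Prop :=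
  ∀ e : Fin n, s a e ≠ 0 ↔ e ∈ S

theorem Marks.setOf_eq {s : Memory} {a : ℕ} {S : Finset (Fin n)} (h : Marks s a S) :
    {e : Fin n | s a e ≠ 0} = (S : Set (Fin n)) :=
  Set.ext h

theorem Marks.congr {s s' : Memory} {a a' : ℕ} {S : Finset (Fin n)} (h : Marks s a S)
    (hs : ∀ e : Fin n, s' a' e = s a e) : Marks s' a' S := fun e => by
  rw [hs e]
  exact h e

theorem Marks.insert {s : Memory} {a j : ℕ} {S : Finset (Fin n)} (h : Marks s a S) (hj : j < n) :
    Marks (s.write a j 1) a (insert ⟨j, hj⟩ S) := fun e => by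
  by_cases he : (e : ℕ) = j
  · subst he
    simp
  · rw [Memory.write_of_ne_index _ _ he, h e, Finset.mem_insert, Fin.ext_iff]
    simp [he]

/-- An item is marked tentatively for an independence query and then unmarked. -/
theorem Marks.insert_erase {s s' : Memory} {a j : ℕ} {S : Finset (Fin n)} (h : Marks s a S)
    (hj : j < n) (hS : (⟨j, hj⟩ : Fin n) ∉ S)
    (hs : ∀ e : Fin n, s' a e = if (e : ℕ) = j then 0 else s a e) :
    Marks s' a S := fun e => by
  rw [hs e]
  by_cases he : (e : ℕ) = j
  · subst he
    simpa using hS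
  · simpa [he] using h e

/-- Copy the marks of array `a` to array `b`. -/
def copy (a b : ℕ) : Program := forItems (.assign b (var 8) (cell a))

theorem det_copy {I : Instance n m} {a b : ℕ} {s : Memory} {S : Finset (Fin n)} (hn : s 0 0 = n)
    (ha : a ≠ b) (hb : b ≠ 0) (hb8 : b ≠ 8) (ha8 : a ≠ 8) (hS : Marks s a S) :
    Det I (copy a b) s (n * 4 + 3) fun s' => Marks s' b S ∧
      ∀ a', a' ∉ [b, 8] → s' a' = s a' := by
  refine (Det.forItems (T := 1) (fun j s' => ∀ i, i < j → s' b i = s a i) hn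
    (by simpa [Program.writes] using hb.symm) (by simpa [Program.writes] using hb8.symm)
    (by simp) ?_).mono le_rfl ?_
  · intro j hj s' h8 hf hI
    refine Det.assign ?_
    intro i hi
    rw [Memory.write_of_ne _ hb8]
    simp only [Expr.eval, h8]
    by_cases hij : i = j
    · subst hij
      rw [Memory.write_self, hf a (by simpa [Program.writes] using ha) ha8]
    · rw [Memory.write_of_ne_index _ _ hij]
      exact hI i (by omega)
  · rintro s' ⟨h1, h2⟩
    exact ⟨hS.congr fun e => h1 e e.isLt, fun a' ha' => by
      simp only [List.mem_cons, List.not_mem_nil, or_false, not_or] at ha'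
      exact h2 a' (by simpa [Program.writes] using ha'.1) ha'.2⟩

/-- The item `e` has been probed and its weight is at most `t`. -/
def LightAt (s : Memory) (t : ℕ) (e : Fin n) : Prop := s 5 e ≠ 0 ∧ s 5 e ≤ t + 1

theorem mem_closure_or_indep {M : Matroid (Fin n)} (hE : M.E = Set.univ) {G : Finset (Fin n)}
    (hG : M.Indep (G : Set (Fin n))) {e : Fin n} :
    ¬ M.Indep ((insert e G : Finset (Fin n)) : Set (Fin n)) → e ∈ M.closure (G : Set (Fin n)) := by
  intro h
  by_contra hcl
  refine h ?_
  rw [Finset.coe_insert, hG.insert_indep_iff]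
  exact Or.inl ⟨by simp [hE], hcl⟩

theorem subset_closure_of_subset {M : Matroid (Fin n)} {G G' : Finset (Fin n)} (h : G ⊆ G')
    {e : Fin n} (he : e ∈ M.closure (G : Set (Fin n))) : e ∈ M.closure (G' : Set (Fin n)) :=
  M.closure_subset_closure (by exact_mod_cast h) he

/-! ### Computing the rank -/

/-- The loop body of `rankProgram`. -/
def rankBody : Program :=
  .seq (.assign 3 (var 8) (.const 1)) (.seq (.indep 3 9)
    (.ifThenElse (var 9) (.assign 1 (.const 0) (.add (var 1) (.const 1)))
      (.assign 3 (var 8) (.const 0))))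

/-- Compute the rank of the matroid in the variable `1`. -/
def rankProgram : Program := forItems rankBody

theorem det_rankProgram {I : Instance n m} {k : ℕ} (hk : I.M.eRank = (k : ℕ∞)) {s : Memory}
    (hn : s 0 0 = n) (h3 : ∀ i, s 3 i = 0) (h1 : s 1 0 = 0) :
    Det I rankProgram s (n * 9 + 3) fun s' => s' 1 0 = k ∧
      ∀ a, a ∉ [1, 3, 8, 9] → s' a = s a := by
  refine (Det.forItems (T := rankBody.cost) (fun j s' => ∃ G : Finset (Fin n), Marks s' 3 G ∧
    I.M.Indep (G : Set (Fin n)) ∧ s' 1 0 = G.card ∧ (∀ e ∈ G, (e : ℕ) < j) ∧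
    ∀ e : Fin n, (e : ℕ) < j → e ∈ I.M.closure (G : Set (Fin n)))
    hn (by decide) (by decide) ?_ ?_).mono le_rfl ?_
  · refine ⟨∅, fun e => by simp [h3], by simp, by simpa using h1, by simp, by simp⟩
  · rintro j hj s' h8 - ⟨G, hG1, hG2, hG3, hG4, hG5⟩
    have hjG : (⟨j, hj⟩ : Fin n) ∉ G := fun h => (hG4 _ h).ne rfl
    have hset := (hG1.insert hj).setOf_eq
    apply Det.of_wp
    simp only [rankBody, wp, Expr.eval, h8, hset]
    refine ⟨fun hi => ⟨fun _ => ?_, fun h => absurd h (by simp)⟩,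
      fun hi => ⟨fun h => absurd (by simp) h, fun _ => ?_⟩⟩
    · refine ⟨insert ⟨j, hj⟩ G, (hG1.insert hj).congr fun e => by simp, hi, ?_, ?_, ?_⟩
      · simp [Finset.card_insert_of_notMem hjG, hG3]
      · intro e he
        rcases Finset.mem_insert.1 he with rfl | he
        · exact Nat.lt_succ_self j
        · exact (hG4 e he).trans (Nat.lt_succ_self j)
      · intro e he
        by_cases hej : (e : ℕ) = j
        · exact I.M.mem_closure_of_mem' (by simp [Fin.ext_iff, hej]) (by simp [I.ground_eq])
        · exact subset_closure_of_subset (Finset.subset_insert _ _) (hG5 e (by omega))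
    · refine ⟨G, hG1.insert_erase hj hjG fun e => ?_, hG2, by simpa using hG3, ?_, ?_⟩
      · simp [Memory.write_apply, h8]
        split_ifs <;> rfl
      · exact fun e he => (hG4 e he).trans (Nat.lt_succ_self j)
      · intro e he
        by_cases hej : (e : ℕ) = j
        · obtain rfl : e = ⟨j, hj⟩ := Fin.ext hej
          exact mem_closure_or_indep I.ground_eq hG2 hi
        · exact hG5 e (by omega)
  · rintro s' ⟨⟨G, -, hG2, hG3, -, hG5⟩, hf⟩
    refine ⟨?_, fun a ha => ?_⟩
    · have hb : I.M.IsBase (G : Set (Fin n)) := by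
        rw [Matroid.isBase_iff_indep_closure_eq]
        refine ⟨hG2, ?_⟩
        rw [I.ground_eq]
        exact Set.eq_univ_of_forall fun e => hG5 e e.isLt
      have := hb.encard_eq_eRank
      rw [hk, Set.encard_coe_eq_coe_finsetCard] at this
      rw [hG3]
      exact_mod_cast this
    · simp only [List.mem_cons, List.not_mem_nil, or_false, not_or] at ha
      refine hf a ?_ ha.2.2.1
      simp [rankBody, Program.writes, ha]

/-! ### Computing the thresholds -/

/-- The loop of `thresholdProgram`. -/
def thresholdLoop : Program :=
  .while (.sub (.read 0 (.const 1)) (.read 6 (var 7)))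
    (.seq (.assign 6 (.add (var 7) (.const 1)) (.add (.read 6 (var 7)) (.read 6 (var 7))))
      (.assign 7 (.const 0) (.add (var 7) (.const 1))))

/-- Compute the thresholds in array `6`, up to the first one that is at least `m`. -/
def thresholdProgram : Program :=
  .seq (.assign 6 (.const 1) (.const 1)) (.seq (.assign 7 (.const 0) (.const 1)) thresholdLoop)

theorem det_thresholdLoop {I : Instance n m} (i : ℕ) :
    ∀ (L : ℕ) (s : Memory), s 0 1 = m → s 7 0 = L → 1 ≤ L → (∀ a ≤ L, s 6 a = threshold a) →
      L ≤ Nat.log 2 m + 2 → Nat.log 2 m + 2 ≤ L + i →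
      Det I thresholdLoop s (i * 4 + 1) fun s' => ∃ L', s' 7 0 = L' ∧
        (∀ a ≤ L', s' 6 a = threshold a) ∧ L' ≤ Nat.log 2 m + 2 ∧ m ≤ threshold L' := by
  induction i with
  | zero =>
    intro L s hm h7 hL h6 hL1 hL2
    have hmL : m ≤ threshold L := by
      -- `i` bounds the doublings still possible; when none is left, the last threshold `2 ^
      -- (Nat.log 2 m + 1)` exceeds `m`.
      obtain rfl : L = Nat.log 2 m + 1 + 1 := by omega
      rw [threshold_succ]
      exact (Nat.lt_pow_succ_log_self (by norm_num) m).le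
    exact ⟨s, 1, by omega, .while_false (by simp [Expr.eval, hm, h7, h6, hmL]), L, h7, h6, hL1, hmL⟩
  | succ i ih =>
    intro L s hm h7 hL h6 hL1 hL2
    by_cases hmL : m ≤ threshold L
    · exact ⟨s, 1, by omega, .while_false (by simp [Expr.eval, hm, h7, h6, hmL]), L, h7, h6, hL1,
        hmL⟩
    · have hlog : L ≤ Nat.log 2 m + 1 := by
        obtain ⟨L, rfl⟩ := Nat.exists_eq_add_of_le' hL
        rw [threshold_succ, not_le] at hmL
        have := Nat.le_log_of_pow_le (by norm_num) hmL.le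
        omega
      obtain ⟨s2, T2, hT2, hb2, hQ2⟩ := ih (L + 1)
        ((s.write 6 (L + 1) (threshold L + threshold L)).write 7 0 (L + 1)) (by simp [hm])
        (by simp) (by omega) (by
          intro a ha
          rw [Memory.write_of_ne _ (by norm_num)]
          by_cases haL : a = L + 1
          · subst haL
            obtain ⟨L, rfl⟩ := Nat.exists_eq_add_of_le' hL
            rw [Memory.write_self, threshold_succ, threshold_succ, pow_succ]
            omega
          · rw [Memory.write_of_ne_index _ _ haL, h6 a (by omega)]) (by omega) (by omega)
      refine ⟨s2, (1 + 1 + 1) + T2 + 1, by omega, .while_true ?_ (.seq (.assign ..) (.assign ..)) ?_,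
        hQ2⟩
      · simp only [Expr.eval, hm, h7, h6 L le_rfl]
        omega
      · simpa [Expr.eval, h7, h6, thresholdLoop] using hb2

theorem det_thresholdProgram {I : Instance n m} {s : Memory} (hm : s 0 1 = m) (h6 : s 6 0 = 0) :
    Det I thresholdProgram s ((Nat.log 2 m + 1) * 4 + 5) fun s' => (∃ L, s' 7 0 = L ∧
        (∀ a ≤ L, s' 6 a = threshold a) ∧ L ≤ Nat.log 2 m + 2 ∧ m ≤ threshold L) ∧
      ∀ a, a ∉ [6, 7] → s' a = s a := by
  refine (Det.frame (Det.seq (Det.assign (Det.seq (Det.assign (det_thresholdLoop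
    (Nat.log 2 m + 1) 1 _ ?_ ?_ le_rfl ?_ ?_ ?_)))))).mono (by omega) ?_
  · simp [hm]
  · simp [Expr.eval]
  · intro a ha
    rcases Nat.le_one_iff_eq_zero_or_eq_one.1 ha with rfl | rfl <;> simp [Expr.eval, threshold, h6]
  · omega
  · omega
  · rintro s' ⟨h1, h2⟩
    refine ⟨h1, fun a ha => h2 a ?_⟩
    simp [thresholdLoop, Program.writes] at ha ⊢
    omega

/-! ### Extending an independent set by probed items -/

/-- The loop body of `extendProgram`. -/
def extendBody : Program :=
  .ifThenElse (both (cell 5) (.sub (.add (var 13) (.const 2)) (cell 5)))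
    (.ifThenElse (cell 3) .skip
      (.ifThenElse (var 14)
        (.seq (.assign 3 (var 8) (.const 1)) (.seq (.indep 3 9)
          (.ifThenElse (var 9) (.assign 14 (.const 0) (.sub (var 14) (.const 1)))
            (.assign 3 (var 8) (.const 0)))))
        .skip))
    .skip

/-- Extend the independent set in array `3` by probed items of weight at most the current threshold,
until it has as many additional elements as the variable `14` says. -/
def extendProgram : Program := forItems extendBody

/-- If elements are still missing at the end, no light probed item was skipped for lack of room, so
every such item is spanned. -/
theorem det_extendProgram {I : Instance n m} {s : Memory} {F : Finset (Fin n)} (hn : s 0 0 = n)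
    (hF : Marks s 3 F) (hFi : I.M.Indep (F : Set (Fin n))) :
    Det I extendProgram s (n * 12 + 3) fun s' => (∃ G : Finset (Fin n), Marks s' 3 G ∧
      I.M.Indep (G : Set (Fin n)) ∧ F ⊆ G ∧ (∀ e ∈ G, e ∉ F → LightAt s (s 13 0) e) ∧
      G.card + s' 14 0 = F.card + s 14 0 ∧
      (s' 14 0 ≠ 0 → ∀ e : Fin n, LightAt s (s 13 0) e → e ∈ I.M.closure (G : Set (Fin n)))) ∧
      ∀ a, a ∉ [3, 8, 9, 14] → s' a = s a := by
  refine (Det.forItems (T := extendBody.cost) (fun j s' => ∃ G : Finset (Fin n), Marks s' 3 G ∧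
      I.M.Indep (G : Set (Fin n)) ∧ F ⊆ G ∧ (∀ e ∈ G, e ∉ F → LightAt s (s 13 0) e) ∧
      G.card + s' 14 0 = F.card + s 14 0 ∧
      (s' 14 0 ≠ 0 → ∀ e : Fin n, (e : ℕ) < j → LightAt s (s 13 0) e →
        e ∈ I.M.closure (G : Set (Fin n))))
    hn (by decide) (by decide) ?_ ?_).mono le_rfl ?_
  · exact ⟨F, hF.congr fun e => by simp, hFi, subset_rfl, fun e h h' => absurd h h', by simp,
      by simp⟩
  · rintro j hj s' h8 hf ⟨G, hG1, hG2, hG3, hG4, hG5, hG6⟩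
    have h5 : s' 5 = s 5 := hf 5 (by decide) (by norm_num)
    have h13 : s' 13 = s 13 := hf 13 (by decide) (by norm_num)
    have hset := (hG1.insert hj).setOf_eq
    have hlight : LightAt s (s 13 0) (⟨j, hj⟩ : Fin n) ↔
        s 5 j - (s 5 j - (s 13 0 + 2 - s 5 j)) ≠ 0 := by
      simp only [LightAt]
      omega
    have hstep : ∀ {G' : Finset (Fin n)} {c : ℕ}, G ⊆ G' → (c ≠ 0 → s' 14 0 ≠ 0) →
        (c ≠ 0 → LightAt s (s 13 0) (⟨j, hj⟩ : Fin n) →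
          (⟨j, hj⟩ : Fin n) ∈ I.M.closure (G' : Set (Fin n))) →
        c ≠ 0 → ∀ e : Fin n, (e : ℕ) < j + 1 → LightAt s (s 13 0) e →
          e ∈ I.M.closure (G' : Set (Fin n)) := by
      intro G' c hGG' hc hcl hc0 e he hle
      by_cases hej : (e : ℕ) = j
      · obtain rfl : e = ⟨j, hj⟩ := Fin.ext hej
        exact hcl hc0 hle
      · exact subset_closure_of_subset hGG' (hG6 (hc hc0) e (by omega) hle)
    apply Det.of_wp
    simp only [extendBody, wp, Expr.eval, eval_both, h8, h5, h13, hset, ← hlight]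
    refine ⟨fun hl => ⟨fun hjG => ?_, fun hjG => ⟨fun hc => ⟨fun hi => ⟨fun _ => ?_, fun h =>
      absurd h (by simp)⟩, fun hi => ⟨fun h => absurd (by simp) h, fun _ => ?_⟩⟩, fun hc => ?_⟩⟩,
      fun hl => ?_⟩
    · refine ⟨G, hG1.congr fun e => by simp, hG2, hG3, hG4, by simpa using hG5, ?_⟩
      simpa using hstep subset_rfl (id : s' 14 0 ≠ 0 → _) fun _ _ =>
        I.M.mem_closure_of_mem' ((hG1 ⟨j, hj⟩).1 hjG) (by simp [I.ground_eq])
    · have hjG' : (⟨j, hj⟩ : Fin n) ∉ G := fun h => (hG1 ⟨j, hj⟩).2 h hjG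
      refine ⟨insert ⟨j, hj⟩ G, (hG1.insert hj).congr fun e => by simp, hi,
        hG3.trans (Finset.subset_insert _ _), ?_, ?_, ?_⟩
      · intro e he heF
        rcases Finset.mem_insert.1 he with rfl | he
        · exact hl
        · exact hG4 e he heF
      · rw [Finset.card_insert_of_notMem hjG']
        simp
        omega
      · refine hstep (Finset.subset_insert _ _) (fun _ => hc) fun _ _ => ?_
        exact I.M.mem_closure_of_mem' (by simp) (by simp [I.ground_eq])
    · have hjG' : (⟨j, hj⟩ : Fin n) ∉ G := fun h => (hG1 ⟨j, hj⟩).2 h hjG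
      refine ⟨G, hG1.insert_erase hj hjG' fun e => ?_, hG2, hG3, hG4, by simpa using hG5, ?_⟩
      · simp [Memory.write_apply, h8]
        split_ifs <;> rfl
      · simpa using hstep subset_rfl (id : s' 14 0 ≠ 0 → _) fun _ _ =>
          mem_closure_or_indep I.ground_eq hG2 hi
    · refine ⟨G, hG1.congr fun e => by simp, hG2, hG3, hG4, by simpa using hG5, ?_⟩
      simpa using hstep subset_rfl (id : s' 14 0 ≠ 0 → _) fun h _ => absurd hc h
    · refine ⟨G, hG1.congr fun e => by simp, hG2, hG3, hG4, by simpa using hG5, ?_⟩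
      simpa using hstep subset_rfl (id : s' 14 0 ≠ 0 → _) fun _ h => absurd hl (hlight.1 h)
  · rintro s' ⟨⟨G, hG1, hG2, hG3, hG4, hG5, hG6⟩, hf⟩
    refine ⟨⟨G, hG1, hG2, hG3, hG4, hG5, fun h e => hG6 h e e.isLt⟩, fun a ha => hf a ?_ ?_⟩
    · simp [extendBody, Program.writes] at ha ⊢
      omega
    · simp at ha
      omega

/-! ### Finding the best item to probe -/

/-- The variable `16` holds an item which among the first `j` items that have not been probed and are not
spanned by `G` is most likely to have a weight of at most `t`, or `n` if there is no such item. -/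
def BestBelow (I : Instance n m) (j : ℕ) (s : Memory) (G : Finset (Fin n)) (t : ℕ) : Prop :=
  (s 16 0 = n ∧ ∀ e : Fin n, (e : ℕ) < j → s 5 e = 0 → e ∈ I.M.closure (G : Set (Fin n))) ∨
  ∃ b : Fin n, s 16 0 = b ∧ s 5 b = 0 ∧ b ∉ I.M.closure (G : Set (Fin n)) ∧
    ∀ e : Fin n, (e : ℕ) < j → s 5 e = 0 →
      e ∈ I.M.closure (G : Set (Fin n)) ∨ I.cdf e t ≤ I.cdf b t

/-- The loop body of `bestProgram`. -/
def bestBody : Program :=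
  .ifThenElse (cell 5) .skip
    (.seq (.assign 3 (var 8) (.const 1)) (.seq (.indep 3 9) (.seq (.assign 3 (var 8) (.const 0))
      (.ifThenElse (var 9)
        (.seq (.compare (var 8) (var 16) (var 13) 9)
          (.ifThenElse (var 9) .skip (.assign 16 (.const 0) (var 8))))
        .skip))))

/-- Find the item outside the span of the set in array `3` that has not been probed and is most likely to
have a weight of at most the current threshold. -/
def bestProgram : Program := .seq (.assign 16 (.const 0) (var 0)) (forItems bestBody)

theorem det_bestProgram {I : Instance n m} {s : Memory} {G : Finset (Fin n)} (hn : s 0 0 = n)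
    (hG : Marks s 3 G) (hGi : I.M.Indep (G : Set (Fin n))) (hGp : ∀ e ∈ G, s 5 e ≠ 0) :
    Det I bestProgram s (n * 15 + 5) fun s' => Marks s' 3 G ∧ BestBelow I n s' G (s 13 0) ∧
      ∀ a, a ∉ [3, 8, 9, 16] → s' a = s a := by
  refine (Det.seq (Det.assign (Det.forItems (T := bestBody.cost) (fun j s' => Marks s' 3 G ∧
    BestBelow I j s' G (s 13 0)) (by simpa using hn) (by decide) (by decide) ?_ ?_))).mono
    (le_of_eq ?_) ?_
  · exact ⟨hG.congr fun e => by simp, Or.inl ⟨by simp [Expr.eval, hn], by simp⟩⟩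
  · rintro j hj s' h8 hf ⟨hG1, hB⟩
    have h5 : s' 5 = s 5 := by rw [hf 5 (by decide) (by norm_num)]; simp
    have h13 : s' 13 = s 13 := by rw [hf 13 (by decide) (by norm_num)]; simp
    have h0 : s' 0 0 = n := by rw [hf 0 (by decide) (by norm_num)]; simpa using hn
    have hset := (hG1.insert hj).setOf_eq
    have hmarks : (⟨j, hj⟩ : Fin n) ∉ G → ∀ s'' : Memory,
        (∀ e : Fin n, s'' 3 e = if (e : ℕ) = j then 0 else s' 3 e) → Marks s'' 3 G :=
      fun h s'' hs => hG1.insert_erase hj h hs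
    have hstep : ∀ s'' : Memory, s'' 16 0 = s' 16 0 → s'' 5 = s' 5 →
        (s' 5 j = 0 → (⟨j, hj⟩ : Fin n) ∈ I.M.closure (G : Set (Fin n)) ∨
          ∃ b : Fin n, s' 16 0 = b ∧ I.cdf ⟨j, hj⟩ (s 13 0) ≤ I.cdf b (s 13 0)) →
        BestBelow I (j + 1) s'' G (s 13 0) := by
      intro s'' h16 h5' h
      rw [BestBelow, h16, h5']
      rcases hB with ⟨hB1, hB2⟩ | ⟨b, hB1, hB2, hB3, hB4⟩
      · refine Or.inl ⟨hB1, fun e he he5 => ?_⟩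
        by_cases hej : (e : ℕ) = j
        · obtain rfl : e = ⟨j, hj⟩ := Fin.ext hej
          rcases h he5 with h | ⟨b, hb, -⟩
          · exact h
          · have := b.isLt
            omega
        · exact hB2 e (by omega) he5
      · refine Or.inr ⟨b, hB1, hB2, hB3, fun e he he5 => ?_⟩
        by_cases hej : (e : ℕ) = j
        · obtain rfl : e = ⟨j, hj⟩ := Fin.ext hej
          refine (h he5).imp id ?_
          rintro ⟨b', hb', hle⟩
          obtain rfl : b' = b := Fin.ext (by omega)
          exact hle
        · exact hB4 e (by omega) he5
    apply Det.of_wp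
    simp only [bestBody, wp, Expr.eval, h8, hset]
    refine ⟨fun hp => ?_, fun hp => ?_⟩
    · exact ⟨hG1.congr fun e => by simp, hstep _ (by simp) (by simp) fun h => absurd h hp⟩
    · have hjG : (⟨j, hj⟩ : Fin n) ∉ G := fun h => hGp _ h (by rw [← h5]; exact hp)
      refine ⟨fun hi => ⟨fun _ => ⟨fun hc => ⟨fun _ => ?_, fun h => absurd h (by simp)⟩,
        fun hc => ⟨fun h => absurd (by simp) h, fun _ => ?_⟩⟩, fun h => absurd h (by simp)⟩,
        fun hi => ⟨fun h => absurd (by simp) h, fun _ => ?_⟩⟩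
      · refine ⟨hmarks hjG _ fun e => ?_, hstep _ (by simp) (by simp) fun _ => Or.inr ?_⟩
        · simp [Memory.write_apply, h8]
          split_ifs <;> rfl
        · obtain ⟨h1, h2, h3⟩ := hc
          simp [h8, h13] at h2 h3
          exact ⟨_, rfl, h3⟩
      -- The initial value `n` is not an item, so a comparison with it is answered by `0` and the
      -- first candidate is always taken.
      · refine ⟨hmarks hjG _ fun e => ?_, Or.inr ⟨⟨j, hj⟩, by simp [h8], by simpa using hp, ?_, ?_⟩⟩
        · simp [Memory.write_apply, h8]
          split_ifs <;> rfl
        · rw [Finset.coe_insert, hGi.insert_indep_iff] at hi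
          rcases hi with hi | hi
          · exact hi.2
          · exact absurd hi hjG
        · intro e he he5
          simp at he5
          by_cases hej : (e : ℕ) = j
          · obtain rfl : e = ⟨j, hj⟩ := Fin.ext hej
            exact Or.inr le_rfl
          · rcases hB with ⟨-, hB2⟩ | ⟨b, hB1, -, -, hB4⟩
            · exact Or.inl (hB2 e (by omega) he5)
            · refine (hB4 e (by omega) he5).imp id fun hle => hle.trans ?_
              simp [h8, h13, hB1, hj] at hc
              exact hc.le
      · refine ⟨hmarks hjG _ fun e => ?_, hstep _ (by simp) (by simp) fun _ => Or.inl ?_⟩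
        · simp [Memory.write_apply, h8]
          split_ifs <;> rfl
        · exact mem_closure_or_indep I.ground_eq hGi hi
  · rw [show bestBody.cost = 12 from rfl]
    omega
  · rintro s' ⟨⟨h1, h2⟩, hf⟩
    refine ⟨h1, h2, fun a ha => ?_⟩
    simp at ha
    rw [hf a (by simp [bestBody, Program.writes]; omega) (by omega), Memory.write_of_ne _ ha.2.2.2]

/-! ### Adaptive probing -/

/-- The weights of the probed items, stored in array `5`, determine the conditional laws `D`. -/
def Knows (I : Instance n m) (s : Memory) (D : Fin n → PMF (Fin (m + 1)))
    (Z : Finset (Fin n)) : Prop :=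
  ∀ e : Fin n, (s 5 e = 0 ∧ D e = I.dist e ∧ e ∉ Z) ∨
    ∃ v : Fin (m + 1), s 5 e = v + 1 ∧ D e = PMF.pure v ∧ e ∈ Z

section Knows

variable {I : Instance n m} {s s' : Memory} {D : Fin n → PMF (Fin (m + 1))} {Z : Finset (Fin n)}

theorem Knows.congr (h : Knows I s D Z) (hs : s' 5 = s 5) : Knows I s' D Z := by
  simpa only [Knows, hs] using h

theorem Knows.mem_iff (h : Knows I s D Z) (e : Fin n) : e ∈ Z ↔ s 5 e ≠ 0 := by
  rcases h e with ⟨h1, -, h2⟩ | ⟨v, h1, -, h2⟩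
  · simp [h1, h2]
  · simp [h1, h2]

theorem Knows.law_eq (h : Knows I s D Z) {e : Fin n} (he : s 5 e = 0) : D e = I.dist e := by
  rcases h e with ⟨-, h1, -⟩ | ⟨v, h1, -, -⟩
  · exact h1
  · omega

theorem Knows.lightAt_iff (h : Knows I s D Z) {x : Fin n → Fin (m + 1)}
    (hx : ∀ e, D e (x e) ≠ 0) {e : Fin n} (he : s 5 e ≠ 0) (t : ℕ) :
    LightAt s t e ↔ (x e : ℕ) ≤ t := by
  rcases h e with ⟨h1, -, -⟩ | ⟨v, h1, h2, -⟩
  · exact absurd h1 he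
  · have := hx e
    rw [h2, PMF.pure_apply] at this
    have hv : x e = v := by
      by_contra hne
      simp [hne] at this
    rw [LightAt, h1, hv]
    omega

theorem Knows.probe (h : Knows I s D Z) {e : Fin n} (v : Fin (m + 1))
    (hs : ∀ e' : Fin n, s' 5 e' = if e' = e then (v : ℕ) + 1 else s 5 e') :
    Knows I s' (Function.update D e (PMF.pure v)) (insert e Z) := by
  intro a
  rw [hs a]
  by_cases hae : a = e
  · subst hae
    exact Or.inr ⟨v, by simp⟩
  · rw [Function.update_of_ne hae]
    simpa [hae] using h a

/-- With the laws `D`, unprobed items that are not better than `e` remain so. -/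
theorem Knows.mem_closure_or_lawCdf_le (h : Knows I s D Z) {G : Finset (Fin n)} {t : ℕ}
    {e : Fin n} (he : s 5 e = 0)
    (hG : ∀ a : Fin n, LightAt s t a → a ∈ I.M.closure (G : Set (Fin n)))
    (hbest : ∀ a : Fin n, s 5 a = 0 → a ∈ I.M.closure (G : Set (Fin n)) ∨ I.cdf a t ≤ I.cdf e t)
    (a : Fin n) : a ∈ I.M.closure (G : Set (Fin n)) ∨ lawCdf D a t ≤ lawCdf D e t := by
  have hcdf : ∀ b : Fin n, s 5 b = 0 → lawCdf D b t = I.cdf b t := fun b hb => by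
    rw [lawCdf, h.law_eq hb]
    rfl
  by_cases ha : s 5 a = 0
  · rw [hcdf a ha, hcdf e he]
    exact hbest a ha
  · rcases h a with ⟨h1, -, -⟩ | ⟨v, h1, h2, -⟩
    · exact absurd h1 ha
    -- A known light item is already spanned; a known heavy one has conditional probability zero of
    -- being light.
    · by_cases hv : (v : ℕ) ≤ t
      · exact Or.inl (hG a ⟨ha, by omega⟩)
      · rw [lawCdf_eq_zero_of_pure h2 hv]
        exact Or.inr zero_le

end Knows

/-- The program that records the observed weight of the item in the variable `16`. -/
def recordProgram : Program :=
  .seq (.assign 5 (var 16) (.add (var 9) (.const 1)))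
    (.seq (.ifThenElse (.sub (.add (var 13) (.const 1)) (var 9))
      (.seq (.assign 3 (var 16) (.const 1)) (.assign 14 (.const 0) (.sub (var 14) (.const 1))))
      .skip) (.assign 15 (.const 0) (.sub (var 15) (.const 1))))

/-- Probe the best items one by one, until the set in array `3` has the required number of elements, the
budget is exhausted, or no useful item is left. -/
def probeLoop : Program :=
  .while (both (var 15) (both (var 14) (.sub (var 0) (var 16))))
    (.seq (.probe (var 16) 9) (.seq recordProgram bestProgram))

/-- The memory `s'` differs from `s` only in the weights of further items and in the arrays that a test
uses. -/
def Extends (n : ℕ) (s s' : Memory) : Prop :=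
  (∀ a, a ∉ [3, 5, 8, 9, 14, 15, 16] → s' a = s a) ∧
    ∀ e : Fin n, s 5 e ≠ 0 → s' 5 e = s 5 e

theorem Extends.refl (s : Memory) : Extends n s s := ⟨fun _ _ => rfl, fun _ _ => rfl⟩

theorem Extends.trans {s s' s'' : Memory} (h : Extends n s s') (h' : Extends n s' s'') :
    Extends n s s'' :=
  ⟨fun a ha => (h'.1 a ha).trans (h.1 a ha), fun e he => by
    rw [h'.2 e (by rwa [h.2 e he]), h.2 e he]⟩

theorem Extends.lightAt {s s' : Memory} (h : Extends n s s') {t : ℕ} {e : Fin n}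
    (he : LightAt s t e) : LightAt s' t e := by
  simpa only [LightAt, h.2 e he.1] using he

/-- The number of items that have not been probed. -/
def unprobed (n : ℕ) (s : Memory) : ℕ := (Finset.univ.filter fun e : Fin n => s 5 e = 0).card

/-- The state of a test after the search for the best item: `G` is the extension found so far. -/
structure Testing (I : Instance n m) (s : Memory) (D : Fin n → PMF (Fin (m + 1)))
    (Z G : Finset (Fin n)) (θ : ℕ) : Prop where
  size : s 0 0 = n
  knows : Knows I s D Z
  marks : Marks s 3 G
  indep : I.M.Indep (G : Set (Fin n))
  probed : ∀ e ∈ G, s 5 e ≠ 0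
  card : G.card + s 14 0 = θ
  light : s 14 0 ≠ 0 → ∀ e : Fin n, LightAt s (s 13 0) e → e ∈ I.M.closure (G : Set (Fin n))

/-- The light items of `S` are all spanned by `G`, so the rank is `|G|`. As the target is not met,
`|G| < θ`, that is, `2 * |G| + 1 < 2 * θ`: a failed test means a certain shortfall. -/
theorem Testing.shortfall_of_best {I : Instance n m} {s : Memory} {D : Fin n → PMF (Fin (m + 1))}
    {Z G : Finset (Fin n)} {θ : ℕ} (h : Testing I s D Z G θ) (h14 : s 14 0 ≠ 0)
    {S : (Fin n → Fin (m + 1)) → Finset (Fin n)}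
    (hS : ∀ x, ∀ e ∈ S x, s 5 e = 0 → e ∈ I.M.closure (G : Set (Fin n))) :
    1 ≤ expect D fun x => shortfall I.M (2 * θ) (s 13 0) G ∅ x (S x) := by
  rw [← expect_const D 1]
  refine expect_mono_of_support fun x hx => ?_
  have hrk : rk I.M ((G ∪ ∅ ∪ MinBasis.light x (s 13 0) (S x) : Finset (Fin n)) : Set (Fin n))
      = G.card := by
    rw [Finset.union_empty, Finset.coe_union, rk_union_of_subset_closure, rk_coe_of_indep _ h.indep]
    intro e he
    simp only [MinBasis.light, Finset.coe_filter, Set.mem_ofPred_eq] at he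
    by_cases h5 : s 5 e = 0
    · exact hS x e he.1 h5
    · exact h.light h14 e ((h.knows.lightAt_iff hx h5 _).2 he.2)
  have := h.card
  rw [shortfall, hrk, if_pos (by omega)]

theorem det_recordProgram {I : Instance n m} {s : Memory} {D : Fin n → PMF (Fin (m + 1))}
    {Z G : Finset (Fin n)} {θ : ℕ} (h : Testing I s D Z G θ) {e : Fin n} (h16 : s 16 0 = e)
    (h5 : s 5 e = 0) (heG : e ∉ I.M.closure (G : Set (Fin n))) (h14 : s 14 0 ≠ 0)
    (v : Fin (m + 1)) :
    Det I (.seq recordProgram bestProgram) (s.write 9 0 v) (n * 15 + 14) fun s' =>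
      Testing I s' (Function.update D e (PMF.pure v)) (insert e Z)
        (if (v : ℕ) ≤ s 13 0 then insert e G else G) θ ∧
      BestBelow I n s' (if (v : ℕ) ≤ s 13 0 then insert e G else G) (s 13 0) ∧
      s' 15 0 = s 15 0 - 1 ∧ Extends n s s' ∧ s' 5 e ≠ 0 ∧
      (v ≤ s 13 0 → LightAt s' (s 13 0) e) := by
  have heG' : e ∉ G := fun he =>
    heG (I.M.mem_closure_of_mem' (by exact_mod_cast he) (by simp [I.ground_eq]))
  have hwp : Det I recordProgram (s.write 9 0 v) recordProgram.cost fun s1 =>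
      Marks s1 3 (if (v : ℕ) ≤ s 13 0 then insert e G else G) ∧
      (∀ e' : Fin n, s1 5 e' = if e' = e then (v : ℕ) + 1 else s 5 e') ∧
      s1 14 0 = (if (v : ℕ) ≤ s 13 0 then s 14 0 - 1 else s 14 0) ∧
      s1 15 0 = s 15 0 - 1 ∧ ∀ a, a ∉ [3, 5, 9, 14, 15] → s1 a = s a := by
    apply Det.of_wp
    simp only [recordProgram, wp, Expr.eval]
    refine ⟨fun hv => ?_, fun hv => ?_⟩
    · have hv' : (v : ℕ) ≤ s 13 0 := by
        simp at hv
        omega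
      simp only [if_pos hv']
      refine ⟨?_, fun e' => ?_, by simp, by simp, fun a ha => ?_⟩
      · have := h.marks.insert e.isLt
        exact this.congr fun e' => by simp [h16, Memory.write_apply]
      · by_cases he' : e' = e
        · simp [he', h16]
        · have : (e' : ℕ) ≠ e := fun h => he' (Fin.ext h)
          simp [he', h16, this]
      · simp only [List.mem_cons, List.not_mem_nil, or_false, not_or] at ha
        simp [ha]
    · have hv' : ¬ (v : ℕ) ≤ s 13 0 := by
        simp at hv
        omega
      simp only [if_neg hv']
      refine ⟨?_, fun e' => ?_, by simp, by simp, fun a ha => ?_⟩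
      · exact h.marks.congr fun e' => by simp
      · by_cases he' : e' = e
        · simp [he', h16]
        · have : (e' : ℕ) ≠ e := fun h => he' (Fin.ext h)
          simp [he', h16, this]
      · simp only [List.mem_cons, List.not_mem_nil, or_false, not_or] at ha
        simp [ha]
  refine (Det.seq (hwp.mono le_rfl fun s1 hs1 => ?_)).mono (T := recordProgram.cost +
    (n * 15 + 5) + 1) (by rw [show recordProgram.cost = 8 from rfl]; omega) fun _ => id
  obtain ⟨h1, h2, h3, h4, h6⟩ := hs1
  have h0 : s1 0 = s 0 := h6 0 (by decide)
  have h13 : s1 13 = s 13 := h6 13 (by decide)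
  have hGi : I.M.Indep ((if (v : ℕ) ≤ s 13 0 then insert e G else G : Finset (Fin n)) :
      Set (Fin n)) := by
    split_ifs
    · rw [Finset.coe_insert, h.indep.insert_indep_iff]
      exact Or.inl ⟨by simp [I.ground_eq], heG⟩
    · exact h.indep
  have hGp : ∀ a ∈ (if (v : ℕ) ≤ s 13 0 then insert e G else G : Finset (Fin n)),
      s1 5 a ≠ 0 := by
    intro a ha
    rw [h2 a]
    split_ifs with hae
    · omega
    · refine h.probed a ?_
      split_ifs at ha
      · exact (Finset.mem_insert.1 ha).resolve_left hae
      · exact ha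
  refine (det_bestProgram (by rw [h0, h.size]) h1 hGi hGp).mono le_rfl ?_
  rintro s2 ⟨hm, hb, hf⟩
  have g0 : s2 0 = s1 0 := hf 0 (by decide)
  have g5 : s2 5 = s1 5 := hf 5 (by decide)
  have g13 : s2 13 = s1 13 := hf 13 (by decide)
  have g14 : s2 14 = s1 14 := hf 14 (by decide)
  have g15 : s2 15 = s1 15 := hf 15 (by decide)
  refine ⟨⟨by rw [g0, h0, h.size], h.knows.probe v fun e' => by rw [g5, h2], hm, hGi,
    fun a ha => by rw [g5]; exact hGp a ha, ?_, ?_⟩, by rwa [h13] at hb, by rw [g15, h4],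
    ⟨fun a ha => ?_, fun a ha => ?_⟩, ?_, fun hv => ?_⟩
  · have := h.card
    rw [g14, h3]
    split_ifs
    · rw [Finset.card_insert_of_notMem heG']
      omega
    · exact this
  · rw [g14, h3, g13, h13]
    intro _ a ha
    rw [LightAt, g5, h2] at ha
    by_cases hae : a = e
    · rw [if_pos hae] at ha
      rw [if_pos (by omega : (v : ℕ) ≤ s 13 0), hae]
      exact I.M.mem_closure_of_mem' (by simp) (by simp [I.ground_eq])
    · rw [if_neg hae] at ha
      refine subset_closure_of_subset ?_ (h.light h14 a ha)
      split_ifs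
      · exact Finset.subset_insert _ _
      · exact subset_rfl
  · simp at ha
    rw [hf a (by simp; omega), h6 a (by simp; omega)]
  · rw [g5, h2, if_neg]
    rintro rfl
    exact ha h5
  · rw [g5, h2, if_pos rfl]
    omega
  · rw [LightAt, g5, h2, if_pos rfl]
    omega

/-- Here `X` bounds the cost in any event and `c` is the surcharge for failing. The remaining
competitor `A` has one probe less after each pass, and `exchange` keeps its expected shortfall from
growing. -/
theorem achieves_probeLoop {I : Instance n m} {K : List Program} {T' b' : ℕ} {s0 : Memory}
    {G0 : Finset (Fin n)} {θ : ℕ} {X : (Fin n → Fin (m + 1)) → ℝ≥0∞} {c : ℝ≥0∞}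
    (hK : ∀ s D Z G, Testing I s D Z G θ → Extends n s0 s → G0 ⊆ G →
      (∀ e ∈ G, e ∉ G0 → LightAt s (s0 13 0) e) →
      Achieves I T' b' ⟨K, s⟩ D Z (expect D X + if s 14 0 = 0 then 0 else c)) (b : ℕ) :
    ∀ s D Z G (A : Policy n m), Testing I s D Z G θ → Extends n s0 s → G0 ⊆ G →
      (∀ e ∈ G, e ∉ G0 → LightAt s (s0 13 0) e) → BestBelow I n s G (s0 13 0) → s 15 0 = b →
      A.depth ≤ b →
      Achieves I (unprobed n s * (n * 15 + 17) + 1 + T') (b + b') ⟨probeLoop :: K, s⟩ D Z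
        (expect D X + c * expect D fun x =>
          shortfall I.M (2 * θ) (s0 13 0) G ∅ x (A.selected x)) := by
  induction b with
  | zero =>
    intro s D Z G A h hs hG0 hGl hB h15 hA
    have h13 : s 13 0 = s0 13 0 := congrFun (hs.1 13 (by decide)) 0
    refine (Achieves.while_false (by simp [Expr.eval, eval_both, h15]) (hK s D Z G h hs hG0 hGl)).mono
      (by omega) (by omega) ?_
    gcongr
    split_ifs with h14
    · exact zero_le
    · refine le_mul_of_one_le_right zero_le ?_
      rw [Policy.eq_done_of_depth hA, ← h13]
      exact h.shortfall_of_best h14 (S := fun _ => ∅) (by simp)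
  | succ b ih =>
    intro s D Z G A h hs hG0 hGl hB h15 hA
    have h13 : s 13 0 = s0 13 0 := congrFun (hs.1 13 (by decide)) 0
    have hexit : s 14 0 = 0 ∨ s 16 0 = n →
        Achieves I (unprobed n s * (n * 15 + 17) + 1 + T') (b + 1 + b') ⟨probeLoop :: K, s⟩ D Z
        (expect D X + c * expect D fun x =>
          shortfall I.M (2 * θ) (s0 13 0) G ∅ x (A.selected x)) := by
      intro hor
      refine (Achieves.while_false ?_ (hK s D Z G h hs hG0 hGl)).mono
        (by omega) (by omega) ?_
      · simp only [Expr.eval, eval_both, h.size]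
        omega
      · gcongr
        split_ifs with h14
        · exact zero_le
        · refine le_mul_of_one_le_right zero_le ?_
          rw [← h13]
          refine h.shortfall_of_best h14 fun x e _ he5 => ?_
          rcases hB with ⟨-, hB⟩ | ⟨e', he', -⟩
          · exact hB e e.isLt he5
          · have := e'.isLt
            omega
    by_cases h14 : s 14 0 = 0
    · exact hexit (Or.inl h14)
    rcases hB with ⟨hB, -⟩ | ⟨e, he, he5, heG, hbest⟩
    · exact hexit (Or.inr hB)
    have heG' : e ∉ G := fun he =>
      heG (I.M.mem_closure_of_mem' (by exact_mod_cast he) (by simp [I.ground_eq]))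
    obtain ⟨Av, hAv1, hAv2⟩ := exchange (θ := 2 * θ) (t := s0 13 0) I.ground_eq heG' A b D ∅ hA
      (fun a _ => by
        rw [Finset.union_empty]
        exact h.knows.mem_closure_or_lawCdf_le he5 (by rw [← h13]; exact h.light h14)
          (fun a ha => hbest a a.isLt ha) a)
    have hun : unprobed n s ≠ 0 := by
      rw [unprobed, Finset.card_ne_zero]
      exact ⟨e, by simp [he5]⟩
    obtain ⟨u, hu⟩ := Nat.exists_eq_add_of_le' (Nat.one_le_iff_ne_zero.2 hun)
    have key : ∀ v : Fin (m + 1), Achieves I ((n * 15 + 14) + (u * (n * 15 + 17) + 1 + T'))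
        (b + b') ⟨.seq recordProgram bestProgram :: probeLoop :: K, s.write 9 0 v⟩
        (Function.update D e (PMF.pure v)) (insert e Z)
        (expect (Function.update D e (PMF.pure v)) X + c * expect (Function.update D e (PMF.pure v))
          fun x => shortfall I.M (2 * θ) (s0 13 0)
            (if (v : ℕ) ≤ s0 13 0 then insert e G else G) ∅ x ((Av v).selected x)) := by
      intro v
      refine Achieves.det (det_recordProgram h he he5 heG h14 v) ?_
      rintro s' ⟨g1, g2, g3, g4, g5, g6⟩
      rw [h13] at g1 g2 g6
      -- Passes are counted by unprobed items, not by the budget, which need not be polynomial in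
      -- `n`.
      have hu' : unprobed n s' ≤ u := by
        refine Nat.lt_succ_iff.1 ((Finset.card_lt_card ?_).trans_eq hu)
        refine Finset.ssubset_iff_subset_ne.2 ⟨fun a ha => ?_, fun heq => ?_⟩
        · simp only [Finset.mem_filter, Finset.mem_univ, true_and] at ha ⊢
          by_contra hne
          rw [g4.2 a hne] at ha
          exact hne ha
        · have : e ∈ Finset.univ.filter fun e : Fin n => s' 5 e = 0 := by
            rw [heq]
            simp [he5]
          simp only [Finset.mem_filter, Finset.mem_univ, true_and] at this
          exact g5 this
      refine (ih s' _ _ _ (Av v) g1 (hs.trans g4) (hG0.trans ?_) ?_ g2 (by omega) (hAv1 v)).mono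
        (by gcongr) le_rfl le_rfl
      · split_ifs
        · exact Finset.subset_insert _ _
        · exact subset_rfl
      · intro a ha haG0
        by_cases hv : (v : ℕ) ≤ s0 13 0
        · rw [if_pos hv] at ha
          rcases Finset.mem_insert.1 ha with rfl | ha
          · exact g6 hv
          · exact g4.lightAt (hGl a ha haG0)
        · rw [if_neg hv] at ha
          exact g4.lightAt (hGl a ha haG0)
    refine (Achieves.while_true ?_ (Achieves.seq (Achieves.probe (by simpa [Expr.eval] using he)
      key))).mono ?_ (by omega) ?_
    · simp only [Expr.eval, eval_both, h.size, he, h15]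
      have := e.isLt
      omega
    · rw [hu, add_mul]
      omega
    -- The `X` parts recombine to `expect D X`; the shortfall parts are bounded by `hAv2`.
    · simp only [mul_add, Finset.sum_add_distrib]
      rw [← expect_eq_sum_update]
      gcongr
      simp only [mul_left_comm _ c]
      rw [← Finset.mul_sum]
      gcongr

/-! ### Searching for a threshold -/

/-- The state between tests: `F` is the independent set chosen so far, `d` elements short of a basis. -/
structure State (I : Instance n m) (L k : ℕ) (s : Memory) (D : Fin n → PMF (Fin (m + 1)))
    (Z F : Finset (Fin n)) (d : ℕ) : Prop where
  size : s 0 0 = n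
  budget : s 0 2 = I.B
  last : s 7 0 = L
  thresholds : ∀ a ≤ L, s 6 a = threshold a
  knows : Knows I s D Z
  marks : Marks s 2 F
  indep : I.M.Indep (F : Set (Fin n))
  probed : ∀ e ∈ F, s 5 e ≠ 0
  deficiency : s 1 0 = d
  card : F.card + d = k

theorem State.of_agree {I : Instance n m} {L k : ℕ} {s s' : Memory}
    {D D' : Fin n → PMF (Fin (m + 1))} {Z Z' F : Finset (Fin n)} {d : ℕ}
    (h : State I L k s D Z F d) (hk : Knows I s' D' Z')
    (ha : ∀ a, a ∈ [0, 1, 2, 6, 7] → s' a = s a)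
    (h5 : ∀ e : Fin n, s 5 e ≠ 0 → s' 5 e ≠ 0) : State I L k s' D' Z' F d where
  size := by rw [ha 0 (by simp), h.size]
  budget := by rw [ha 0 (by simp), h.budget]
  last := by rw [ha 7 (by simp), h.last]
  thresholds := fun a hL => by rw [ha 6 (by simp), h.thresholds a hL]
  knows := hk
  marks := h.marks.congr fun e => by rw [ha 2 (by simp)]
  indep := h.indep
  probed := fun e he => h5 e (h.probed e he)
  deficiency := by rw [ha 1 (by simp), h.deficiency]
  card := h.card

/-- Prepare a test of the threshold in the middle of the search interval. -/
def setupProgram : Program :=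
  .seq (.seq (.assign 17 (.const 0) (.half (.add (var 11) (var 12))))
    (.seq (.assign 13 (.const 0) (.read 6 (var 17)))
      (.seq (.assign 14 (.const 0) (var 10)) (.assign 15 (.const 0) (.read 0 (.const 2))))))
    (.seq (copy 2 3) (.seq extendProgram bestProgram))

/-- Update the search interval after a test. -/
def decideProgram : Program :=
  .ifThenElse (var 14) (.assign 11 (.const 0) (.add (var 17) (.const 1)))
    (.seq (.assign 12 (.const 0) (var 17)) (copy 3 4))

/-- Search for a threshold for which the quota can be met. -/
def searchLoop : Program :=
  .while (.sub (var 12) (var 11)) (.seq setupProgram (.seq probeLoop decideProgram))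

theorem det_setupProgram {I : Instance n m} {L k : ℕ} {s : Memory}
    {D : Fin n → PMF (Fin (m + 1))} {Z F : Finset (Fin n)} {d g mid : ℕ}
    (h : State I L k s D Z F d) (h10 : s 10 0 = g) (hmid : (s 11 0 + s 12 0) / 2 = mid)
    (hL : mid ≤ L) :
    Det I setupProgram s (n * 31 + 21) fun s' => (∃ G, Testing I s' D Z G (F.card + g) ∧ F ⊆ G ∧
      (∀ e ∈ G, e ∉ F → LightAt s' (threshold mid) e) ∧ BestBelow I n s' G (threshold mid)) ∧
      s' 15 0 = I.B ∧ s' 13 0 = threshold mid ∧ s' 17 0 = mid ∧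
      ∀ a, a ∉ [3, 8, 9, 13, 14, 15, 16, 17] → s' a = s a := by
  have hvars : Det I (.seq (.assign 17 (.const 0) (.half (.add (var 11) (var 12))))
    (.seq (.assign 13 (.const 0) (.read 6 (var 17)))
      (.seq (.assign 14 (.const 0) (var 10)) (.assign 15 (.const 0) (.read 0 (.const 2)))))) s 7
      fun s1 => s1 17 0 = mid ∧ s1 13 0 = threshold mid ∧ s1 14 0 = g ∧ s1 15 0 = I.B ∧
        ∀ a, a ∉ [13, 14, 15, 17] → s1 a = s a := by
    refine (Det.of_wp ?_).mono (le_of_eq rfl) fun _ => id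
    simp only [wp, Expr.eval]
    refine ⟨by simp [hmid], by simp [hmid, h.thresholds mid hL], by simp [h10],
      by simp [h.budget], fun a ha => ?_⟩
    simp only [List.mem_cons, List.not_mem_nil, or_false, not_or] at ha
    simp [ha]
  refine (Det.seq (hvars.mono le_rfl fun s1 hs1 => Det.seq (T := n * 4 + 3)
    (T' := (n * 12 + 3) + (n * 15 + 5) + 1) ?_)).mono (by omega) fun _ => id
  obtain ⟨a17, a13, a14, a15, af⟩ := hs1
  refine (det_copy (a := 2) (b := 3) (by rw [af 0 (by decide), h.size]) (by norm_num)
    (by norm_num) (by norm_num) (by norm_num)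
    (h.marks.congr fun e => by rw [af 2 (by decide)])).mono le_rfl ?_
  rintro s2 ⟨b1, bf⟩
  refine Det.seq ((det_extendProgram (by rw [bf 0 (by decide), af 0 (by decide), h.size]) b1
    h.indep).mono le_rfl ?_)
  rintro s3 ⟨⟨G, c1, c2, c3, c4, c5, c6⟩, cf⟩
  have e0 : s3 0 = s 0 := by rw [cf 0 (by decide), bf 0 (by decide), af 0 (by decide)]
  have e5 : s3 5 = s 5 := by rw [cf 5 (by decide), bf 5 (by decide), af 5 (by decide)]
  have e25 : s2 5 = s 5 := by rw [bf 5 (by decide), af 5 (by decide)]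
  have e213 : s2 13 0 = threshold mid := by rw [bf 13 (by decide), a13]
  have e313 : s3 13 0 = threshold mid := by rw [cf 13 (by decide), e213]
  have e214 : s2 14 0 = g := by rw [bf 14 (by decide), a14]
  have hGp : ∀ e ∈ G, s 5 e ≠ 0 := by
    intro e he
    by_cases heF : e ∈ F
    · exact h.probed e heF
    · have := (c4 e he heF).1
      rwa [e25] at this
  refine (det_bestProgram (by rw [e0, h.size]) c1 c2 (by rwa [e5])).mono le_rfl ?_
  rintro s4 ⟨d1, d2, df⟩
  have f5 : s4 5 = s 5 := by rw [df 5 (by decide), e5]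
  have f13 : s4 13 0 = threshold mid := by rw [df 13 (by decide), e313]
  have f14 : s4 14 = s3 14 := df 14 (by decide)
  refine ⟨⟨G, ⟨by rw [df 0 (by decide), e0, h.size], h.knows.congr f5, d1, c2, by rwa [f5], ?_, ?_⟩,
    c3, ?_, by rwa [e313] at d2⟩, ?_, f13, ?_, fun a ha => ?_⟩
  · rw [f14, c5, e214]
  · rw [f14, f13]
    simpa only [LightAt, f5, e25, e213] using c6
  · simpa only [LightAt, f5, e25, e213] using c4
  · rw [df 15 (by decide), cf 15 (by decide), bf 15 (by decide), a15]
  · rw [df 17 (by decide), cf 17 (by decide), bf 17 (by decide), a17]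
  · simp at ha
    rw [df a (by simp; omega), cf a (by simp; omega), bf a (by simp; omega), af a (by simp; omega)]

/-- Array `4` holds an independent extension of `F` by `g` probed items of weight at most `t`. -/
def HasExtension (I : Instance n m) (s : Memory) (F : Finset (Fin n)) (g t : ℕ) : Prop :=
  ∃ H : Finset (Fin n), Marks s 4 H ∧ I.M.Indep (H : Set (Fin n)) ∧ F ⊆ H ∧
    (∀ e ∈ H, e ∉ F → LightAt s t e) ∧ H.card = F.card + g

/-! ### The cost potential and its change during a search -/

section Potential

variable (I : Instance n m) (L k : ℕ) (A : Policy n m)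

/-- The weight of `F` and what the phases from the deficiency `d` on may cost. -/
def potential (F : Finset (Fin n)) (d : ℕ) (x : Fin n → Fin (m + 1)) : ℝ≥0∞ :=
  ∑ e ∈ F, ((x e : ℕ) : ℝ≥0∞) + ∑ a ∈ Finset.range (L + 1),
    price L (a + 1) * (charge d (deficit I.M k (threshold a) x (A.selected x)) : ℝ≥0∞)

/-- What the thresholds in `S` may contribute to the cost of a phase with deficiency `d`. -/
def risk (d : ℕ) (S : Finset ℕ) (x : Fin n → Fin (m + 1)) : ℝ≥0∞ :=
  ∑ a ∈ S, price L (a + 1) *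
    if d + 2 - 2 * quota d ≤ deficit I.M k (threshold a) x (A.selected x) then 1 else 0

variable {I L k A}

/-- Splits off the current phase. Its search starts at index `0`, whose price is zero. -/
theorem potential_of_pos {F : Finset (Fin n)} {d : ℕ} (hd : d ≠ 0) (x : Fin n → Fin (m + 1)) :
    potential I L k A F d x = potential I L k A F (d - quota d) x
      + quota d * (price L 0 + risk I L k A d (Finset.Ico 0 (L + 1)) x) := by
  simp only [potential, risk, charge_of_pos hd, add_assoc]
  congr 1
  rw [show price L 0 = 0 by simp [price, threshold], zero_add, Finset.mul_sum,
    Nat.Ico_zero_eq_range, ← Finset.sum_add_distrib]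
  refine Finset.sum_congr rfl fun a _ => ?_
  push_cast
  split_ifs
  · simp
    ring
  · simp

theorem risk_Ico {d lo mid hi : ℕ} (h1 : lo ≤ mid) (h2 : mid < hi) (x : Fin n → Fin (m + 1)) :
    risk I L k A d (Finset.Ico lo hi) x
      = risk I L k A d (Finset.Ico lo mid) x + risk I L k A d (Finset.Ico (mid + 1) hi) x +
        price L (mid + 1) *
          if d + 2 - 2 * quota d ≤ deficit I.M k (threshold mid) x (A.selected x) then 1 else 0 := by
  simp only [risk]
  rw [← Finset.sum_Ico_consecutive _ h1 h2.le, Finset.sum_eq_sum_Ico_succ_bot h2]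
  ring

end Potential

/-- Halving the search interval uses up one test, so `Nat.size` of its length counts the tests. -/
theorem size_add_one_le {l' l : ℕ} (h : 2 * l' ≤ l) (hl : l ≠ 0) : l'.size + 1 ≤ l.size := by
  rcases hs : l'.size with _ | j
  · exact Nat.lt_size.2 (by simpa using Nat.one_le_iff_ne_zero.2 hl)
  · have : 2 ^ j ≤ l' := Nat.lt_size.1 (by omega)
    exact Nat.lt_size.2 (by rw [pow_succ]; omega)

/-- Dropping `G` from the union and shrinking `G` to `F` in the cardinality only lowers the sum;
`|F| = k - d` turns the bound on the rank into one on the deficit. -/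
theorem shortfall_le {I : Instance n m} {k d t : ℕ} {F G : Finset (Fin n)} (hFG : F ⊆ G)
    (hF : F.card + d = k) (x : Fin n → Fin (m + 1)) (S : Finset (Fin n)) :
    shortfall I.M (2 * (F.card + quota d)) t G ∅ x S
      ≤ if d + 2 - 2 * quota d ≤ deficit I.M k t x S then 1 else 0 := by
  have h1 := Finset.card_le_card hFG
  have h2 : rk I.M ((light x t S : Finset (Fin n)) : Set (Fin n))
      ≤ rk I.M ((G ∪ ∅ ∪ light x t S : Finset (Fin n)) : Set (Fin n)) :=
    rk_mono _ (by exact_mod_cast Finset.subset_union_right)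
  unfold shortfall
  by_cases h : rk I.M ((G ∪ ∅ ∪ light x t S : Finset (Fin n)) : Set (Fin n)) + G.card + 1
      < 2 * (F.card + quota d)
  · have hd : d + 2 - 2 * quota d ≤ deficit I.M k t x S := by
      simp only [deficit]
      omega
    rw [if_pos h, if_pos hd]
  · rw [if_neg h]
    exact zero_le

/-- The price of the lower end plus the risk of the interval bounds the expected price at which the
search ends. The upper end always has a stored extension, except for `L + 1`, which stands for none
found. -/
theorem achieves_searchLoop {I : Instance n m} {L k : ℕ} {A : Policy n m} (hA : A.depth ≤ I.B)
    {K : List Program} {T' b' : ℕ} {F : Finset (Fin n)} {d : ℕ}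
    (hK : ∀ s D Z a, State I L k s D Z F d → s 10 0 = quota d → s 11 0 = a → a ≤ L + 1 →
      (a ≤ L → HasExtension I s F (quota d) (threshold a)) →
      Achieves I T' b' ⟨K, s⟩ D Z
        (expect D fun x => potential I L k A F (d - quota d) x + quota d * price L a)) (l : ℕ) :
    ∀ s D Z lo hi, State I L k s D Z F d → s 10 0 = quota d → s 11 0 = lo → s 12 0 = hi →
      lo + l = hi → hi ≤ L + 1 → (hi ≤ L → HasExtension I s F (quota d) (threshold hi)) →
      Achieves I (l.size * (n * (n * 15 + 17) + n * 35 + 31) + 1 + T') (l.size * I.B + b')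
        ⟨searchLoop :: K, s⟩ D Z (expect D fun x => potential I L k A F (d - quota d) x
          + quota d * (price L lo + risk I L k A d (Finset.Ico lo hi) x)) := by
  induction l using Nat.strong_induction_on with
  | _ l ih =>
    intro s D Z lo hi h h10 h11 h12 hl hhi hext
    rcases Nat.eq_zero_or_pos l with rfl | hlpos
    · obtain rfl : lo = hi := by omega
      refine (Achieves.while_false (by simp [Expr.eval, h11, h12])
        (hK s D Z lo h h10 h11 hhi hext)).mono (by omega) (by omega) (le_of_eq ?_)
      simp [risk]
    set mid := (lo + hi) / 2 with hmid
    have hlm : lo ≤ mid := by omega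
    have hmh : mid < hi := by omega
    have hmidL : mid ≤ L := by omega
    have hsize : l.size ≠ 0 := (Nat.size_pos.2 hlpos).ne'
    obtain ⟨z, hz⟩ := Nat.exists_eq_add_of_le' (Nat.one_le_iff_ne_zero.2 hsize)
    have hdec : ∀ l', 2 * l' ≤ l → l'.size ≤ z := fun l' hl' => by
      have := size_add_one_le hl' hlpos.ne'
      omega
    refine (Achieves.while_true (T := (n * 31 + 21) + (((n * (n * 15 + 17) + 1 + ((n * 4 + 6) +
      (z * (n * (n * 15 + 17) + n * 35 + 31) + 1 + T'))) + 1)) + 1) (b := I.B + (z * I.B + b'))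
      (by simp only [Expr.eval, h11, h12]; omega) (Achieves.seq (Achieves.det
      (det_setupProgram h h10 (by rw [h11, h12]) hmidL) ?_))).mono ?_ ?_ le_rfl
    · rintro s1 ⟨⟨G, g1, g2, g3, g4⟩, g15, g13, g17, gf⟩
      refine Achieves.seq ((achieves_probeLoop (s0 := s1) (G0 := F) (θ := F.card + quota d)
        (T' := (n * 4 + 6) + (z * (n * (n * 15 + 17) + n * 35 + 31) + 1 + T'))
        -- `X` keeps the risks on both sides of `mid`; the risk of `mid` itself becomes the
        -- surcharge `c`, paid only if the test fails.
        (X := fun x => potential I L k A F (d - quota d) x + quota d * (price L lo +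
          (risk I L k A d (Finset.Ico lo mid) x + risk I L k A d (Finset.Ico (mid + 1) hi) x)))
        (c := quota d * price L (mid + 1)) ?_ I.B s1 D Z G A g1 (.refl s1) g2 (by rwa [g13])
        (by rwa [g13]) g15 hA).mono ?_ le_rfl ?_)
      · intro s2 D2 Z2 G2 k1 k2 k3 k4
        rw [g13] at k4
        have e2 : ∀ a, a ∉ [3, 5, 8, 9, 13, 14, 15, 16, 17] → s2 a = s a := fun a ha => by
          simp at ha
          rw [k2.1 a (by simp; omega), gf a (by simp; omega)]
        have h5 : ∀ e : Fin n, s 5 e ≠ 0 → s2 5 e = s 5 e := fun e he => by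
          rw [k2.2 e (by rwa [gf 5 (by decide)]), gf 5 (by decide)]
        have h17 : s2 17 0 = mid := by rw [k2.1 17 (by decide), g17]
        by_cases h14 : s2 14 0 = 0
        · refine Achieves.det (Q := fun s3 => Marks s3 4 G2 ∧ s3 12 0 = mid ∧
            ∀ a, a ∉ [4, 8, 12] → s3 a = s2 a) (T := n * 4 + 6) ?_ ?_
          · refine (Det.ite (T := 1 + (n * 4 + 3) + 1) ?_ ?_).mono (by omega) fun _ => id
            · exact fun h => absurd h14 h
            refine fun _ => Det.seq (Det.assign ((det_copy (a := 3) (b := 4) ?_ (by norm_num)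
              (by norm_num) (by norm_num) (by norm_num)
              (k1.marks.congr fun e => by simp)).mono le_rfl ?_))
            · simpa using k1.size
            · rintro s3 ⟨m1, mf⟩
              refine ⟨m1, by rw [mf 12 (by decide)]; simp [Expr.eval, h17], fun a ha => ?_⟩
              simp at ha
              rw [mf a (by simp; omega), Memory.write_of_ne _ ha.2.2]
          · rintro s3 ⟨m1, m2, mf⟩
            have q5 : s3 5 = s2 5 := mf 5 (by decide)
            have hlt : mid - lo < l := by omega
            refine (ih (mid - lo) hlt s3 D2 Z2 lo mid (h.of_agree (k1.knows.congr q5) ?_ ?_)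
              (by rw [mf 10 (by decide), e2 10 (by decide), h10])
              (by rw [mf 11 (by decide), e2 11 (by decide), h11]) m2 (by omega) (by omega)
              fun _ => ?_).mono ?_ ?_ ?_
            · intro a ha
              simp at ha
              rw [mf a (by simp; omega), e2 a (by simp; omega)]
            · intro e he
              rw [q5, h5 e he]
              exact he
            · refine ⟨G2, m1, k1.indep, k3, ?_, ?_⟩
              · simpa only [LightAt, q5] using k4
              · have := k1.card
                omega
            · gcongr
              exact hdec _ (by omega)
            · gcongr
              exact hdec _ (by omega)
            -- After a success the risk above `mid` is discarded.
            · rw [if_pos h14, add_zero]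
              refine expect_mono fun x => ?_
              gcongr
              exact le_self_add
        · refine Achieves.det (Q := fun s3 => s3 11 0 = mid + 1 ∧
            ∀ a, a ∉ [11] → s3 a = s2 a) (T := n * 4 + 6) ?_ ?_
          · refine (Det.ite (T := 1) (fun _ => Det.assign ?_) ?_).mono (by omega) fun _ => id
            swap
            · exact fun h => absurd h h14
            refine ⟨by simp [Expr.eval, h17], fun a ha => ?_⟩
            simp at ha
            rw [Memory.write_of_ne _ ha]
          · rintro s3 ⟨m2, mf⟩
            have q5 : s3 5 = s2 5 := mf 5 (by decide)
            have hlt : hi - (mid + 1) < l := by omega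
            refine (ih (hi - (mid + 1)) hlt s3 D2 Z2 (mid + 1) hi
              (h.of_agree (k1.knows.congr q5) ?_ ?_)
              (by rw [mf 10 (by decide), e2 10 (by decide), h10]) m2
              (by rw [mf 12 (by decide), e2 12 (by decide), h12]) (by omega) hhi
              fun hL => ?_).mono ?_ ?_ ?_
            · intro a ha
              simp at ha
              rw [mf a (by simp; omega), e2 a (by simp; omega)]
            · intro e he
              rw [q5, h5 e he]
              exact he
            · obtain ⟨H, r1, r2, r3, r4, r5⟩ := hext hL
              refine ⟨H, r1.congr fun e => by rw [mf 4 (by decide), e2 4 (by decide)], r2, r3,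
                fun e he heF => ?_, r5⟩
              have := r4 e he heF
              simpa only [LightAt, q5, h5 e this.1] using this
            · gcongr
              exact hdec _ (by omega)
            · gcongr
              exact hdec _ (by omega)
            -- After a failure the surcharge is the price of the new lower end, and the old price
            -- and the risk below `mid` are discarded.
            · rw [if_neg h14, ← expect_const D2 (quota d * price L (mid + 1)), ← expect_add]
              refine expect_mono fun x => ?_
              rw [mul_add, add_assoc]
              gcongr _ + ?_
              rw [add_comm, mul_add, mul_add]
              gcongr
              exact le_add_self.trans le_add_self
      · gcongr
        exact (Finset.card_filter_le _ _).trans (by simp)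
      · rw [← expect_mul_left, ← expect_add]
        refine expect_mono fun x => ?_
        rw [risk_Ico hlm hmh, g13]
        have := shortfall_le (I := I) (t := threshold mid) g2 h.card x (A.selected x)
        refine le_of_eq_of_le (b := potential I L k A F (d - quota d) x + quota d * (price L lo +
          (risk I L k A d (Finset.Ico lo mid) x + risk I L k A d (Finset.Ico (mid + 1) hi) x +
          price L (mid + 1) * shortfall I.M (2 * (F.card + quota d)) (threshold mid) G ∅ x
            (A.selected x)))) (by ring) ?_
        gcongr
    · rw [hz, add_mul]
      omega
    · rw [hz, add_mul]
      omega

/-! ### The main loop -/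

/-- Prepare a phase. -/
def phaseSetup : Program :=
  .seq (.assign 10 (.const 0) (.add (.half (.half (var 1))) (.const 1)))
    (.seq (.assign 11 (.const 0) (.const 0)) (.assign 12 (.const 0) (.add (var 7) (.const 1))))

/-- Commit to the extension found in a phase, or give up if there is none. -/
def phaseEnd : Program :=
  .ifThenElse (.sub (.add (var 7) (.const 1)) (var 11))
    (.seq (copy 4 2) (.assign 1 (.const 0) (.sub (var 1) (var 10))))
    (.assign 1 (.const 0) (.const 0))

/-- Run phases until there is a basis. -/
def mainLoop : Program := .while (var 1) (.seq phaseSetup (.seq searchLoop phaseEnd))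

/-- The algorithm. -/
def mainProgram : Program := .seq rankProgram (.seq thresholdProgram mainLoop)

theorem State.objective_le {I : Instance n m} {L k : ℕ} (hk : I.M.eRank = (k : ℕ∞)) {s : Memory}
    {D : Fin n → PMF (Fin (m + 1))} {Z F : Finset (Fin n)} (h : State I L k s D Z F 0)
    (x : Fin n → Fin (m + 1)) : I.objective x Z ≤ ∑ e ∈ F, ((x e : ℕ) : ℝ≥0∞) := by
  have hb : I.M.IsBase (F : Set (Fin n)) := by
    refine h.indep.isBase_of_eRk_ge F.finite_toSet ?_
    rw [hk, h.indep.eRk_eq_encard, Set.encard_coe_eq_coe_finsetCard, ← h.card]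
    simp
  exact iInf_le_of_le ⟨F, fun e he => (h.knows.mem_iff e).2 (h.probed e he), hb⟩ le_rfl

theorem State.extend {I : Instance n m} {L k : ℕ} {s s' : Memory}
    {D : Fin n → PMF (Fin (m + 1))} {Z F H : Finset (Fin n)} {d t : ℕ}
    (h : State I L k s D Z F d) (hd : d ≠ 0) (hHi : I.M.Indep (H : Set (Fin n)))
    (hHl : ∀ e ∈ H, e ∉ F → LightAt s t e) (hHc : H.card = F.card + quota d)
    (hH : Marks s' 2 H) (h1 : s' 1 0 = d - quota d)
    (hs : ∀ a, a ∈ [0, 5, 6, 7] → s' a = s a) :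
    State I L k s' D Z H (d - quota d) where
  size := by rw [hs 0 (by simp), h.size]
  budget := by rw [hs 0 (by simp), h.budget]
  last := by rw [hs 7 (by simp), h.last]
  thresholds := fun a hL => by rw [hs 6 (by simp), h.thresholds a hL]
  knows := h.knows.congr (hs 5 (by simp))
  marks := hH
  indep := hHi
  probed := fun e he => by
    rw [hs 5 (by simp)]
    by_cases heF : e ∈ F
    · exact h.probed e heF
    · exact (hHl e he heF).1
  deficiency := h1
  card := by
    have := h.card
    have : quota d ≤ d := by simp only [quota]; omega
    omega

theorem sum_le_of_light {I : Instance n m} {s : Memory} {D : Fin n → PMF (Fin (m + 1))}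
    {Z F H : Finset (Fin n)} {g t : ℕ} (h : Knows I s D Z) (hFH : F ⊆ H)
    (hH : ∀ e ∈ H, e ∉ F → LightAt s t e) (hc : H.card = F.card + g)
    {x : Fin n → Fin (m + 1)} (hx : ∀ e, D e (x e) ≠ 0) :
    ∑ e ∈ H, ((x e : ℕ) : ℝ≥0∞) ≤ ∑ e ∈ F, ((x e : ℕ) : ℝ≥0∞) + g * t := by
  rw [← Finset.sum_sdiff hFH, add_comm]
  gcongr
  have hcard : (H \ F).card = g := by
    rw [Finset.card_sdiff_of_subset hFH]
    omega
  rw [← hcard, ← nsmul_eq_mul]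
  refine Finset.sum_le_card_nsmul _ _ _ fun e he => ?_
  rw [Finset.mem_sdiff] at he
  have hl := hH e he.1 he.2
  exact_mod_cast (h.lightAt_iff hx hl.1 t).1 hl

/-- A phase trades `quota d` times the final price for the weight of the new elements. At deficiency
zero, `F` is a basis of probed items and the potential dominates its weight. -/
theorem achieves_mainLoop {I : Instance n m} {L k : ℕ} (hk : I.M.eRank = (k : ℕ∞))
    {A : Policy n m} (hA : A.depth ≤ I.B) (d : ℕ) :
    ∀ s D Z F, State I L k s D Z F d →
      Achieves I (phases d * ((L + 1).size * (n * (n * 15 + 17) + n * 35 + 31) + n * 4 + 15) + 1)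
        (phases d * ((L + 1).size * I.B)) ⟨[mainLoop], s⟩ D Z
        (expect D (potential I L k A F d)) := by
  induction d using Nat.strong_induction_on with
  | _ d ih =>
    intro s D Z F h
    by_cases hd : d = 0
    · subst hd
      refine (Achieves.while_false (T := 0) (by simp [Expr.eval, h.deficiency])
        (Achieves.halt ?_)).mono (by omega) (Nat.zero_le _) le_rfl
      refine expect_mono fun x => (h.objective_le hk x).trans le_self_add
    set τ := n * (n * 15 + 17) + n * 35 + 31 with hτ
    have hq : quota d ≤ d := by simp only [quota]; omega
    have hq0 : 0 < quota d := by simp only [quota]; omega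
    set P := phases (d - quota d) * ((L + 1).size * τ + n * 4 + 15) + 1 with hP
    refine (Achieves.while_true (T := (5 + (((L + 1).size * τ + 1 + ((n * 4 + 6) + P)) + 1)) + 1)
      (b := (L + 1).size * I.B + phases (d - quota d) * ((L + 1).size * I.B))
      (by simpa [Expr.eval, h.deficiency] using hd) (Achieves.seq (Achieves.det
      (Q := fun s1 => s1 10 0 = quota d ∧ s1 11 0 = 0 ∧ s1 12 0 = L + 1 ∧
        ∀ a, a ∉ [10, 11, 12] → s1 a = s a) ?_ ?_))).mono ?_ ?_ le_rfl
    · refine (Det.of_wp ?_).mono (le_of_eq rfl) fun _ => id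
      simp only [phaseSetup, wp, Expr.eval]
      refine ⟨?_, by simp, by simp [h.last], fun a ha => ?_⟩
      · simp only [quota, h.deficiency]
        simp
        omega
      · simp only [List.mem_cons, List.not_mem_nil, or_false, not_or] at ha
        simp [ha]
    · rintro s1 ⟨e1, e2, e3, e4⟩
      refine Achieves.seq ((achieves_searchLoop hA (F := F) (d := d) ?_ (L + 1) s1 D Z 0 (L + 1)
        (h.of_agree (h.knows.congr (e4 5 (by decide))) ?_ ?_) e1 e2 e3 (by omega) le_rfl
        (fun h => absurd h (by omega))).mono le_rfl le_rfl (le_of_eq ?_))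
      · intro s2 D2 Z2 a h2 h10 h11 haL hext
        by_cases hle : a ≤ L
        · obtain ⟨H, r1, r2, r3, r4, r5⟩ := hext hle
          refine Achieves.det (Q := fun s3 => Marks s3 2 H ∧ s3 1 0 = d - quota d ∧
            ∀ a, a ∈ [0, 5, 6, 7] → s3 a = s2 a) ?_ ?_
          · refine (Det.ite (T := (n * 4 + 3) + 1 + 1) (fun _ => Det.seq ((det_copy (a := 4)
              (b := 2) h2.size (by norm_num) (by norm_num) (by norm_num) (by norm_num)
              r1).mono le_rfl ?_)) ?_).mono (by omega) fun _ => id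
            · rintro s3 ⟨m1, mf⟩
              refine Det.assign ⟨m1.congr fun e => by simp, ?_, fun a ha => ?_⟩
              · simp [Expr.eval, mf, h2.deficiency, h10]
              · simp at ha
                rw [Memory.write_of_ne _ (by omega), mf a (by simp; omega)]
            · simp only [Expr.eval, h2.last, h11]
              intro h0
              omega
          · rintro s3 ⟨m1, m2, mf⟩
            refine (ih (d - quota d) (by omega) s3 D2 Z2 H
              (h2.extend hd r2 r4 r5 m1 m2 mf)).mono le_rfl le_rfl ?_
            refine expect_mono_of_support fun x hx => ?_
            rw [price, if_pos hle]
            simp only [potential]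
            rw [add_right_comm]
            gcongr
            exact sum_le_of_light h2.knows r3 r4 r5 hx
        -- No threshold succeeded: the final price is `⊤`, so giving up satisfies the bound whatever
        -- the objective.
        · refine Achieves.det (Q := fun s3 => s3 1 0 = 0) ?_ ?_
          · refine (Det.ite (T := 1) ?_ fun _ => Det.assign (by simp [Expr.eval])).mono
              (by omega) fun _ => id
            simp only [Expr.eval, h2.last, h11]
            intro h0
            omega
          · intro s3 h31
            refine (Achieves.while_false (T := 0) (r := ⊤) (b := 0) (by simpa [Expr.eval] using h31)
              (Achieves.halt le_top)).mono (by omega) (Nat.zero_le _) ?_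
            rw [← expect_const D2 ⊤]
            refine expect_mono fun x => ?_
            rw [price, if_neg hle, ENNReal.mul_top (by exact_mod_cast hq0.ne')]
            simp
      · intro a ha
        simp at ha
        exact e4 a (by simp; omega)
      · intro e he
        rwa [e4 5 (by decide)]
      · congr 1
        funext x
        rw [potential_of_pos hd]
    · rw [phases_of_pos hd, add_mul]
      omega
    · rw [phases_of_pos hd, add_mul]
      omega

theorem achieves_mainProgram (I : Instance n m) {k : ℕ} (hk : I.M.eRank = (k : ℕ∞))
    {A : Policy n m} (hA : A.depth ≤ I.B) :
    Achieves I ((n * 9 + 3) + (((Nat.log 2 m + 1) * 4 + 5) + (phases k *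
        ((Nat.log 2 m + 2 + 1).size * (n * (n * 15 + 17) + n * 35 + 31) + n * 4 + 15) + 1) + 1) + 1)
      (phases k * ((Nat.log 2 m + 2 + 1).size * I.B)) ⟨[mainProgram], I.input⟩ I.dist ∅
      (8 * expect I.dist fun x => I.objective x (A.selected x)) := by
  refine Achieves.seq (Achieves.det (det_rankProgram hk (by simp [Instance.input])
    (by simp [Instance.input]) (by simp [Instance.input])) ?_)
  rintro s1 ⟨a1, af⟩
  have hm : s1 0 1 = m := by
    rw [af 0 (by decide)]
    simp [Instance.input]
  have h6 : s1 6 0 = 0 := by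
    rw [af 6 (by decide)]
    simp [Instance.input]
  refine Achieves.seq (Achieves.det (det_thresholdProgram hm h6) ?_)
  rintro s2 ⟨⟨L, b1, b2, b3, b4⟩, bf⟩
  have e0 : s2 0 = I.input 0 := by rw [bf 0 (by decide), af 0 (by decide)]
  have e2 : s2 2 = I.input 2 := by rw [bf 2 (by decide), af 2 (by decide)]
  have e5 : s2 5 = I.input 5 := by rw [bf 5 (by decide), af 5 (by decide)]
  have hsize : (L + 1).size ≤ (Nat.log 2 m + 2 + 1).size := Nat.size_le_size (by omega)
  refine (achieves_mainLoop hk hA k s2 I.dist ∅ ∅ ⟨by simp [e0, Instance.input],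
    by simp [e0, Instance.input], b1, b2, fun e => Or.inl ⟨by simp [e5, Instance.input], rfl,
    by simp⟩, fun e => by simp [e2, Instance.input], by simp, by simp,
    by rw [bf 1 (by decide), a1], by simp⟩).mono (by gcongr) (by gcongr) ?_
  rw [← expect_mul_left]
  refine expect_mono fun x => ?_
  rw [potential, Finset.sum_empty, zero_add]
  exact I.sum_price_mul_charge_le hk b4 x (A.selected x)

/-- A polynomial bound for the number of steps. -/
def timeBound : Polynomial ℕ :=
  (.X * 9 + 3) + (((.X + 1) * 4 + 5) + (.X *
    ((.X + 3) * (.X * (.X * 15 + 17) + .X * 35 + 31) + .X * 4 + 15) + 1) + 1) + 1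

theorem le_eval_timeBound {k : ℕ} (hkn : k ≤ n) :
    (n * 9 + 3) + (((Nat.log 2 m + 1) * 4 + 5) + (phases k *
        ((Nat.log 2 m + 2 + 1).size * (n * (n * 15 + 17) + n * 35 + 31) + n * 4 + 15) + 1) + 1) + 1
      ≤ timeBound.eval (n + Nat.log 2 m) := by
  have h1 : phases k ≤ n + Nat.log 2 m := (phases_le_self k).trans (by omega)
  -- The bit length is bounded by the number itself, which suffices for a polynomial.
  have h2 : (Nat.log 2 m + 2 + 1).size ≤ n + Nat.log 2 m + 3 :=
    (Nat.size_le.2 Nat.lt_two_pow_self).trans (by omega)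
  have h3 : n ≤ n + Nat.log 2 m := by omega
  have h4 : Nat.log 2 m ≤ n + Nat.log 2 m := by omega
  generalize hN : n + Nat.log 2 m = N at *
  simp only [timeBound, Polynomial.eval_add, Polynomial.eval_mul, Polynomial.eval_X,
    Polynomial.eval_ofNat, Polynomial.eval_one]
  gcongr

end MinBasis

end

/-! ### The approximation guarantee -/

theorem theorem4 :
    ∃ (P : MinBasis.Program) (q : Polynomial ℕ) (C : ℝ),
      ∀ (n m k : ℕ) (I : MinBasis.Instance n m), I.M.eRank = (k : ℕ∞) →
        ∃ π : MinBasis.Policy n m,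
          P.Implements I (q.eval (n + Nat.log 2 m)) π ∧
          I.IsApproximation 8
            (C * (max 1 (Real.log (Real.log (m : ℝ))) * max 1 (Real.log (k : ℝ)))) π := by
  refine ⟨MinBasis.mainProgram, MinBasis.timeBound, 55, fun n m k I hk => ?_⟩
  have hkn : k ≤ n := by
    have := I.M.eRank_le_encard_ground
    rw [hk, I.ground_eq, Set.encard_univ] at this
    simpa using this
  -- The analysis always mentions a competitor; the trivial one suffices to obtain the policy, its
  -- running time and its number of probes.
  obtain ⟨π, hπ1, hπ2, -⟩ := MinBasis.achieves_mainProgram I hk (A := .done) (Nat.zero_le _)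
  refine ⟨π, hπ1.mono (MinBasis.le_eval_timeBound hkn), fun x => ?_, fun π' hπ' => ?_⟩
  · obtain ⟨F, hF1, hF2⟩ := MinBasis.exists_biUnion_card_le I.B
      (MinBasis.phases k * (Nat.log 2 m + 2 + 1).size) (π.selected x)
      ((hπ2 x).trans_eq (mul_assoc _ _ _).symm)
    refine ⟨_, F, ?_, hF1, hF2⟩
    have h1 := MinBasis.phases_le k
    have h2 := MinBasis.size_le m (Nat.log 2 m + 2) le_rfl
    push_cast
    calc (MinBasis.phases k : ℝ) * ((Nat.log 2 m + 2 + 1).size : ℝ)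
        ≤ (5 * max 1 (Real.log k)) * (11 * max 1 (Real.log (Real.log m))) := by gcongr
      _ = _ := by ring
  · obtain ⟨A, hA1, hA2⟩ := π'.exists_depth_le_of_card_le I.B hπ'
    obtain ⟨ρ, hρ1, -, hρ3⟩ := MinBasis.achieves_mainProgram I hk hA1
    -- The analysis against `A` concerns the same run of the program, hence the same policy.
    obtain rfl := hπ1.unique hρ1
    simp only [Finset.empty_union, hA2] at hρ3
    exact hρ3
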